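/- Let $d\in\{2,3\}$, $\mathbb{T}=\mathbb{R}/2\pi\mathbb{Z}$ and $\mathbb{T}^*=(\mathbb{R}/\mathbb{Z})\times\mathbb{R}^{d-1}$, where $\mathbb{R}/\mathbb{Z}$ is identified with $[0,1)$. For $\xi=(\xi_1,\xi')\in\mathbb{T}^*$ put $|\xi_1|_*=\min_{n\in\mathbb{Z}}|\xi_1-n|$ and $|\xi|_*=(|\xi_1|_*^2+|\xi'|^2)^{1/2}$. Let $A$ be the operator on $L^2(\mathbb{R}^d;\mathbb{C})$ with domain $H^2(\mathbb{R}^d)$ given by $$A=-\Delta+i\cos x_1\,\partial_2\quad(d=2),\qquad A=-\Delta+i\cos x_1\,\partial_2+i\sin x_1\,\partial_3\quad(d=3),$$ and for $\xi\in\mathbb{T}^*$ let $A_\xi=e^{-i\xi\cdot x}Ae^{i\xi\cdot x}$ be the corresponding fibre operator on $L^2(\mathbb{T};\mathbb{C})$ with domain $H^2(\mathbb{T})$, that is, $$A_\xi=-\partial_{x_1}^2-2i\xi_1\partial_{x_1}+|\xi|^2-\xi_2\cos x_1\quad(d=2),$$ $$A_\xi=-\partial_{x_1}^2-2i\xi_1\partial_{x_1}+|\xi|^2-\xi_2\cos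 x_1-\xi_3\sin x_1\quad(d=3).$$ For $n=0,1,2,\dots$ let $\lambda_n(\xi)$ be the $n$-th eigenvalue of $A_\xi$, where the eigenvalues are listed in nondecreasing order $\lambda_0(\xi)\le\lambda_1(\xi)\le\cdots$ and counted with multiplicity; that is, $\lambda_n(\xi)$ is the least real $\mu$ such that $A_\xi$ has $n+1$ linearly independent eigenfunctions with eigenvalues at most $\mu$. These numbers are well defined for all $\xi\in\mathbb{T}^*$ and $n\ge0$, and there exist constants $\theta_0>0$ and $C>0$ such that for all $\xi\in\mathbb{T}^*$ $$\lambda_0(\xi)\ge\theta_0|\xi|_*^2,\qquad \lambda_n(\xi)\ge C\quad\text{for all } n\ge1.$$ Moreover, the spectrum of $A$ is contained in $[0,\infty)$. -/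

import Mathlib

open MeasureTheory
open scoped SchwartzMap LineDeriv Laplacian ENNReal

noncomputable section

/-! ### Unbounded operators on a complex Hilbert space -/

section Unbounded

variable {H : Type*} [NormedAddCommGroup H] [InnerProductSpace ℂ H]

/-- The resolvent set of an unbounded operator `T` : those `z` for which `T - z` is a bijection
from the domain of `T` onto the whole space, with a bounded inverse `R`. -/
def pmapResolventSet (T : H →ₗ.[ℂ] H) : Set ℂ :=
  {z | ∃ R : H →L[ℂ] H,
    (∀ y : H, ∃ x : T.domain, (x : H) = R y ∧ T x - z • (x : H) = y) ∧
    ∀ x : T.domain, R (T x - z • (x : H)) = (x : H)}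

/-- The spectrum of an unbounded operator. -/
def pmapSpectrum (T : H →ₗ.[ℂ] H) : Set ℂ := (pmapResolventSet T)ᶜ

/-- `f` lies in the domain of `T` and `T f = ν f`. -/
def IsEigenfunctionOrZero (T : H →ₗ.[ℂ] H) (ν : ℝ) (f : H) : Prop :=
  ∃ hf : f ∈ T.domain, T ⟨f, hf⟩ = (ν : ℂ) • f

/-- The real numbers `μ` such that at least `n + 1` eigenvalues of `T`, counted with multiplicity,
are at most `μ`, that is, such that `T` has `n + 1` linearly independent eigenfunctions
with eigenvalues at most `μ`. -/
def eigenvalueCountSet (T : H →ₗ.[ℂ] H) (n : ℕ) : Set ℝ :=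
  {μ | ∃ (ν : Fin (n + 1) → ℝ) (φ : Fin (n + 1) → H), LinearIndependent ℂ φ ∧
    ∀ j, ν j ≤ μ ∧ IsEigenfunctionOrZero T (ν j) (φ j)}

/-- The `n`-th eigenvalue (`n = 0, 1, 2, …`) of `T`, in nondecreasing order and counted with
multiplicity: the smallest `μ` such that at least `n + 1` eigenvalues are at most `μ`. -/
def nthEigenvalue (T : H →ₗ.[ℂ] H) (n : ℕ) : ℝ := sInf (eigenvalueCountSet T n)

/-- A linear map `T` into `X` with values in the range of an injective linear map `j : H → X`,
regarded as a map into `H`. -/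
def liftAlong {S X : Type*} [AddCommGroup S] [Module ℂ S] [AddCommGroup X] [Module ℂ X]
    (j : H →ₗ[ℂ] X) (hj : Function.Injective j) (T : S →ₗ[ℂ] X)
    (h : ∀ u, ∃ g, j g = T u) : S →ₗ[ℂ] H :=
  (LinearEquiv.ofInjective j hj).symm.toLinearMap ∘ₗ T.codRestrict (LinearMap.range j) h

theorem liftAlong_spec {S X : Type*} [AddCommGroup S] [Module ℂ S] [AddCommGroup X] [Module ℂ X]
    (j : H →ₗ[ℂ] X) (hj : Function.Injective j) (T : S →ₗ[ℂ] X)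
    (h : ∀ u, ∃ g, j g = T u) (u : S) : j (liftAlong j hj T h u) = T u := by
  have := congrArg Subtype.val
    ((LinearEquiv.ofInjective j hj).apply_symm_apply (T.codRestrict (LinearMap.range j) h u))
  exact this

end Unbounded

/-- Multiplication by an essentially bounded function, as an operator on `L²(μ)`. -/
def mulL2 {α : Type*} [MeasurableSpace α] (μ : Measure α) (b : α → ℂ) (hb : MemLp b ∞ μ) :
    Lp ℂ 2 μ →ₗ[ℂ] Lp ℂ 2 μ where
  toFun u := (hb.toLp b • u : Lp ℂ 2 μ)
  map_add' _ _ := Lp.add_smul _ _ _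
  map_smul' c u := (Lp.smul_comm c (hb.toLp b) u).symm

/-! ### The periodic coefficients -/

/-- The coefficient of `i ∂_j`, as a function of `x₁`. The coordinates of `ℝ^d` are numbered from
`0` here, so that the coordinates `x₁, x₂, x₃` have the indices `0, 1, 2`: the coefficient is
`cos x₁` for `∂₂`, `sin x₁` for `∂₃`, and there is none for `∂₁`. -/
def helixCoeff : ℕ → ℝ → ℝ
  | 1 => Real.cos
  | 2 => Real.sin
  | _ => fun _ => 0

theorem helixCoeff_periodic (j : ℕ) : Function.Periodic (helixCoeff j) (2 * Real.pi) := by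
  match j with
  | 0 => intro x; rfl
  | 1 => exact Real.cos_periodic
  | 2 => exact Real.sin_periodic
  | _ + 3 => intro x; rfl

theorem helixCoeff_continuous (j : ℕ) : Continuous (helixCoeff j) := by
  match j with
  | 0 => exact continuous_const
  | 1 => exact Real.continuous_cos
  | 2 => exact Real.continuous_sin
  | _ + 3 => exact continuous_const

theorem helixCoeff_abs_le (j : ℕ) (x : ℝ) : |helixCoeff j x| ≤ 1 := by
  match j with
  | 0 => simp [helixCoeff]
  | 1 => exact Real.abs_cos_le_one x
  | 2 => exact Real.abs_sin_le_one x
  | _ + 3 => simp [helixCoeff]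

/-! ### The operator `A = -Δ + i cos x₁ ∂₂ (+ i sin x₁ ∂₃)` on `L²(ℝ^d)` -/

section WholeSpace

variable (d : ℕ)

/-- `L²(ℝ^d)`, complex-valued. -/
abbrev L2Space : Type := Lp ℂ 2 (volume : Measure (EuclideanSpace ℝ (Fin d)))

/-- The inclusion of `L²(ℝ^d)` into the tempered distributions. -/
def toDistr : L2Space d →ₗ[ℂ] 𝓢'(EuclideanSpace ℝ (Fin d), ℂ) :=
  (Lp.toTemperedDistributionCLM ℂ (volume : Measure (EuclideanSpace ℝ (Fin d))) 2).toLinearMap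

theorem toDistr_injective : Function.Injective (toDistr d) :=
  LinearMap.ker_eq_bot.mp Lp.ker_toTemperedDistributionCLM_eq_bot

/-- The Sobolev space `H²(ℝ^d)` as a subspace of `L²(ℝ^d)`. -/
def sobolevH2 : Submodule ℂ (L2Space d) where
  carrier := {u | TemperedDistribution.MemSobolev 2 2 (toDistr d u)}
  zero_mem' := by
    simp
  add_mem' {u v} hu hv := by
    have h := TemperedDistribution.MemSobolev.add hu hv
    simpa using h
  smul_mem' c u hu := by
    have h := TemperedDistribution.MemSobolev.smul c hu
    simpa using h

/-- The distributional derivative `∂_j : H²(ℝ^d) → L²(ℝ^d)`. -/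
def partialH2 (j : Fin d) : sobolevH2 d →ₗ[ℂ] L2Space d :=
  liftAlong (toDistr d) (toDistr_injective d)
    ((LineDeriv.lineDerivOpCLM ℂ 𝓢'(EuclideanSpace ℝ (Fin d), ℂ)
      (EuclideanSpace.single j (1 : ℝ))).toLinearMap ∘ₗ toDistr d ∘ₗ (sobolevH2 d).subtype)
    (by
      intro u
      have h := (TemperedDistribution.MemSobolev.lineDerivOp
        (m := EuclideanSpace.single j (1 : ℝ)) u.2).mono (s' := 0) (by norm_num)
      obtain ⟨g, hg⟩ := TemperedDistribution.memSobolev_zero_iff.mp h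
      exact ⟨g, hg.symm⟩)

/-- The distributional Laplacian `Δ : H²(ℝ^d) → L²(ℝ^d)`. -/
def laplacianH2 : sobolevH2 d →ₗ[ℂ] L2Space d :=
  liftAlong (toDistr d) (toDistr_injective d)
    ((LineDeriv.laplacianCLM ℂ (EuclideanSpace ℝ (Fin d))
      𝓢'(EuclideanSpace ℝ (Fin d), ℂ)).toLinearMap ∘ₗ toDistr d ∘ₗ (sobolevH2 d).subtype)
    (by
      intro u
      have h := (TemperedDistribution.MemSobolev.laplacian u.2).mono (s' := 0) (by norm_num)
      obtain ⟨g, hg⟩ := TemperedDistribution.memSobolev_zero_iff.mp h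
      exact ⟨g, (hg.symm.trans (TemperedDistribution.laplacianCLM_apply _).symm)⟩)

theorem helixCoeff_memLp_space [NeZero d] (j : ℕ) :
    MemLp (fun x : EuclideanSpace ℝ (Fin d) => (helixCoeff j (x 0) : ℂ)) ∞ volume := by
  refine memLp_top_of_bound (C := 1) ?_ (Filter.Eventually.of_forall fun x => ?_)
  · have h : Continuous fun x : EuclideanSpace ℝ (Fin d) => (helixCoeff j (x 0) : ℂ) :=
      Complex.continuous_ofReal.comp ((helixCoeff_continuous j).comp (by fun_prop))
    exact h.aestronglyMeasurable
  · simpa using helixCoeff_abs_le j (x 0)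

/-- The operator `A = -Δ + i cos x₁ ∂₂` if `d = 2`, and `A = -Δ + i cos x₁ ∂₂ + i sin x₁ ∂₃` if
`d = 3`, as an unbounded operator on `L²(ℝ^d)` with domain `H²(ℝ^d)`. -/
def helixOperator [NeZero d] : L2Space d →ₗ.[ℂ] L2Space d where
  domain := sobolevH2 d
  toFun := -laplacianH2 d + Complex.I • ∑ j : Fin d,
    mulL2 volume _ (helixCoeff_memLp_space d (j : ℕ)) ∘ₗ partialH2 d j

end WholeSpace

/-! ### The fibre operators `A_ξ` on `L²(𝕋)`, `𝕋 = ℝ / 2πℤ` -/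

section Fibre

instance fact_two_pi_pos : Fact (0 < 2 * Real.pi) := ⟨Real.two_pi_pos⟩

/-- `L²(𝕋)`, complex-valued, for `𝕋 = ℝ / 2πℤ`. The measure is `dx₁ / 2π`: the normalization only
scales the inner product. -/
abbrev L2Circle : Type := Lp ℂ 2 (AddCircle.haarAddCircle : Measure (AddCircle (2 * Real.pi)))

/-- The Fourier coefficients `k ↦ (2π)⁻¹ ∫ e^{-ikx₁} u(x₁) dx₁`. -/
def circleCoeff : L2Circle →ₗ[ℂ] (ℤ → ℂ) where
  toFun u k := fourierCoeff u k
  map_add' u v := by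
    funext k
    simp only [← fourierBasis_repr, map_add, Pi.add_apply, lp.coeFn_add]
  map_smul' c u := by
    funext k
    simp only [← fourierBasis_repr, map_smul, Pi.smul_apply, lp.coeFn_smul, RingHom.id_apply]

theorem circleCoeff_injective : Function.Injective circleCoeff := by
  intro u v h
  apply (fourierBasis (T := 2 * Real.pi)).repr.injective
  ext k
  rw [fourierBasis_repr, fourierBasis_repr]
  exact congrFun h k

/-- Differentiation `∂^m` in Fourier coefficients: multiplication by `(ik)^m`. -/
def coeffDeriv (m : ℕ) : (ℤ → ℂ) →ₗ[ℂ] (ℤ → ℂ) where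
  toFun a k := (Complex.I * (k : ℂ)) ^ m * a k
  map_add' a b := by funext k; simp [mul_add]
  map_smul' c a := by funext k; simp [mul_left_comm]

/-- The Sobolev space `H²(𝕋)`: the `u ∈ L²(𝕋)` whose (distributional) derivatives `∂u` and `∂²u`
belong to `L²(𝕋)`. A function `v` is the derivative `∂^m u` if and only if its Fourier
coefficients are `(ik)^m` times those of `u`. -/
def circleH2 : Submodule ℂ L2Circle :=
  (LinearMap.range circleCoeff).comap (coeffDeriv 1 ∘ₗ circleCoeff) ⊓
    (LinearMap.range circleCoeff).comap (coeffDeriv 2 ∘ₗ circleCoeff)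

/-- The derivative `∂ : H²(𝕋) → L²(𝕋)`. -/
def circleDeriv : circleH2 →ₗ[ℂ] L2Circle :=
  liftAlong circleCoeff circleCoeff_injective
    (coeffDeriv 1 ∘ₗ circleCoeff ∘ₗ circleH2.subtype)
    (by
      intro u
      obtain ⟨g, hg⟩ := u.2.1
      exact ⟨g, hg⟩)

/-- The second derivative `∂² : H²(𝕋) → L²(𝕋)`. -/
def circleDeriv2 : circleH2 →ₗ[ℂ] L2Circle :=
  liftAlong circleCoeff circleCoeff_injective
    (coeffDeriv 2 ∘ₗ circleCoeff ∘ₗ circleH2.subtype)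
    (by
      intro u
      obtain ⟨g, hg⟩ := u.2.2
      exact ⟨g, hg⟩)

variable {d : ℕ}

/-- The potential `ξ₂ cos x₁` if `d = 2`, and `ξ₂ cos x₁ + ξ₃ sin x₁` if `d = 3`, as a function on
`ℝ / 2πℤ`. -/
def fibrePotential (ξ : EuclideanSpace ℝ (Fin d)) (x : AddCircle (2 * Real.pi)) : ℝ :=
  ∑ j : Fin d, ξ j * (helixCoeff_periodic (j : ℕ)).lift x

theorem fibrePotential_continuous (ξ : EuclideanSpace ℝ (Fin d)) :
    Continuous (fibrePotential ξ) := by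
  unfold fibrePotential
  refine continuous_finsetSum _ fun j _ => continuous_const.mul ?_
  exact continuous_coinduced_dom.mpr (helixCoeff_continuous (j : ℕ))

theorem fibrePotential_memLp (ξ : EuclideanSpace ℝ (Fin d)) :
    MemLp (fun x => (fibrePotential ξ x : ℂ)) ∞
      (AddCircle.haarAddCircle : Measure (AddCircle (2 * Real.pi))) := by
  have h : Continuous fun x => (fibrePotential ξ x : ℂ) :=
    Complex.continuous_ofReal.comp (fibrePotential_continuous ξ)
  obtain ⟨C, hC⟩ := isCompact_univ.exists_bound_of_continuousOn h.continuousOn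
  exact memLp_top_of_bound h.aestronglyMeasurable C
    (Filter.Eventually.of_forall fun x => hC x (Set.mem_univ x))

/-- The operator `A_ξ = -∂² - 2iξ₁∂ + |ξ|² - ξ₂ cos x₁` if `d = 2`, and
`A_ξ = -∂² - 2iξ₁∂ + |ξ|² - ξ₂ cos x₁ - ξ₃ sin x₁` if `d = 3`, as an unbounded operator on `L²(𝕋)`
with domain `H²(𝕋)`. -/
def fibreOperator [NeZero d] (ξ : EuclideanSpace ℝ (Fin d)) : L2Circle →ₗ.[ℂ] L2Circle where
  domain := circleH2
  toFun := -circleDeriv2 - (2 * Complex.I * (ξ 0 : ℂ)) • circleDeriv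
    + ((‖ξ‖ ^ 2 : ℝ) : ℂ) • circleH2.subtype
    - mulL2 _ _ (fibrePotential_memLp ξ) ∘ₗ circleH2.subtype

/-- The eigenvalues `λ₀(ξ) ≤ λ₁(ξ) ≤ …` of `A_ξ`, counted with multiplicity. -/
def blochEigenvalue [NeZero d] (n : ℕ) (ξ : EuclideanSpace ℝ (Fin d)) : ℝ :=
  nthEigenvalue (fibreOperator ξ) n

variable (d) in
/-- `𝕋* = (ℝ / ℤ) × ℝ^{d-1}`, with `ℝ / ℤ` identified with `[0, 1)`. -/
def dualTorus [NeZero d] : Set (EuclideanSpace ℝ (Fin d)) := {ξ | ξ 0 ∈ Set.Ico (0 : ℝ) 1}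

/-- `|ξ|_* = (|ξ₁|_*² + |ξ'|²)^{1/2}`, where `|ξ₁|_*` is the distance from `ξ₁` to the nearest
integer. -/
def starNorm [NeZero d] (ξ : EuclideanSpace ℝ (Fin d)) : ℝ :=
  √((⨅ n : ℤ, |ξ 0 - n|) ^ 2 + ∑ j ∈ Finset.univ.erase (0 : Fin d), ξ j ^ 2)

end Fibre

end

/-!
In Fourier coefficients `A_ξ` is a Jacobi operator with diagonal `d_k = (k + ξ₁)² + |ξ'|²`, whose
off-diagonal entries have modulus `|ξ'| / 2`. The identity `d_k d_{k+1} - |ξ'|² = (|ξ'|² + (k +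
ξ₁)(k + 1 + ξ₁))²` bounds the interaction of two neighbouring modes by the diagonal, and an uneven
splitting of the diagonal entries between their two neighbours gains a factor: the form of `A_ξ` is
at least one tenth of the form of its diagonal part (`tsum_mul_shift_le`,
`freeFibre_sub_potential_form`). Since `d_k ≥ |ξ|_*²` for all `k`, and `d_k ≥ 1 / 4` for all `k`
but one, the min-max principle gives the bounds on the eigenvalues with `θ₀ = 1 / 10` and `C = 1 /
40` (`le_of_mem_eigenvalueCountSet`). As `d_k → ∞`, it also shows that only finitely many
eigenvalues lie below any bound; that there are infinitely many follows from the compactness of the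
resolvent (`isLeast_blochEigenvalue`).

The form of `A` is nonnegative for a reason that does not need the fibre decomposition. The
coefficients `cos x₁, sin x₁` are the derivatives of `sin x₁, -cos x₁`, and integrating by parts
twice turns the first-order term of the form into `∫ 2 Im (conj (∂₁u) ∑ s_j ∂_j u)` with `∑ s_j² ≤
1`, which is dominated by `∫ |∇u|²` (`schwartz_form_nonneg`). Density of Schwartz functions gives
the same on `H²` (`helixOperator_form_nonneg`).

Both operators are small perturbations of constant-coefficient operators far from the spectrum, so
that a Neumann series yields the positive resolvent at one point (`exists_positive_resolvent`), and
its numerical range confines the spectrum to `[0, ∞)` (`pmapSpectrum_subset_nonneg`).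
-/

/-! ### Unbounded operators with nonnegative quadratic form -/

section UnboundedTheory

open scoped ComplexOrder

variable {H : Type*} [NormedAddCommGroup H] [InnerProductSpace ℂ H]

/-- An operator `T` with nonnegative quadratic form that has an approximate right inverse `G` of
`T + c`, with an error `K` of norm less than `1`, has the bounded positive resolvent
`(T + c)⁻¹ = G (1 + K)⁻¹`. The factor `G` is displayed because compactness of `G` passes to the
resolvent. -/
theorem exists_positive_resolvent [CompleteSpace H] {T : H →ₗ.[ℂ] H}
    (hT : ∀ u : T.domain, 0 ≤ inner ℂ (u : H) (T u)) {c : ℝ} (hc : 0 < c) {G K : H →L[ℂ] H}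
    (hK : ‖K‖ < 1)
    (hG : ∀ f, ∃ u : T.domain, (u : H) = G f ∧ T u + (c : ℂ) • (u : H) = f + K f) :
    ∃ S : H →L[ℂ] H, (G ∘L S).IsPositive ∧
      (∀ y, c * ‖(G ∘L S) y‖ ≤ ‖y‖) ∧
      (∀ y, ∃ u : T.domain, (u : H) = (G ∘L S) y ∧ T u + (c : ℂ) • (u : H) = y) ∧
      ∀ u : T.domain, (G ∘L S) (T u + (c : ℂ) • (u : H)) = u := by
  have hunit : IsUnit (1 + K) := by
    have := isUnit_one_sub_of_norm_lt_one (x := -K) (by simpa using hK)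
    simpa using this
  obtain ⟨v, hv⟩ := hunit
  set S : H →L[ℂ] H := ↑v⁻¹ with hS
  have hKS : ∀ y, S y + K (S y) = y := by
    intro y
    have h : ((v : H →L[ℂ] H) * S) y = y := by rw [hS, Units.mul_inv]; rfl
    rw [hv] at h
    simpa using h
  have hsurj : ∀ y, ∃ u : T.domain, (u : H) = (G ∘L S) y ∧ T u + (c : ℂ) • (u : H) = y := by
    intro y
    obtain ⟨u, hu, hu'⟩ := hG (S y)
    exact ⟨u, hu, by rw [hu', hKS]⟩
  -- the form of `T + c` dominates `c ‖u‖²`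
  have hform : ∀ u : T.domain, ((c * ‖(u : H)‖ ^ 2 : ℝ) : ℂ) ≤
      inner ℂ (u : H) (T u + (c : ℂ) • (u : H)) := by
    intro u
    rw [inner_add_right, inner_smul_right, inner_self_eq_norm_sq_to_K]
    have := hT u
    simpa using this
  have hbound : ∀ u : T.domain, c * ‖(u : H)‖ ≤ ‖T u + (c : ℂ) • (u : H)‖ := by
    intro u
    have h1 := (Complex.le_def.mp (hform u)).1
    rw [Complex.ofReal_re] at h1
    have h2 := h1.trans (re_inner_le_norm (𝕜 := ℂ) (u : H) (T u + (c : ℂ) • (u : H)))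
    rcases (norm_nonneg (u : H)).eq_or_lt with h0 | h0
    · rw [← h0]; simp
    · nlinarith
  refine ⟨S, ?_, ?_, hsurj, ?_⟩
  · rw [ContinuousLinearMap.isPositive_iff_complex]
    intro y
    obtain ⟨u, hu, hu'⟩ := hsurj y
    have h := hform u
    rw [hu', hu] at h
    have h0 : (0 : ℂ) ≤ inner ℂ ((G ∘L S) y) y :=
      le_trans (by norm_cast; positivity) h
    have h1 := Complex.le_def.mp h0
    refine ⟨?_, h1.1⟩
    apply Complex.ext
    · simp
    · simpa using h1.2
  · intro y
    obtain ⟨u, hu, hu'⟩ := hsurj y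
    have := hbound u
    rwa [hu', hu] at this
  · intro u
    obtain ⟨w, hw, hw'⟩ := hsurj (T u + (c : ℂ) • (u : H))
    have h := hbound (w - u)
    have h2 : T (w - u) + (c : ℂ) • ((w - u : T.domain) : H) = 0 := by
      rw [T.map_sub, Submodule.coe_sub, smul_sub, ← sub_eq_zero.mpr hw']
      abel
    rw [h2, norm_zero] at h
    have h3 : ‖((w - u : T.domain) : H)‖ = 0 := by
      have := norm_nonneg ((w - u : T.domain) : H)
      nlinarith
    rw [norm_eq_zero, Submodule.coe_sub, sub_eq_zero] at h3
    rw [← hw, h3]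

/-- The spectrum of `T` lies in `[0, ∞)` if `R = (T + c)⁻¹` is positive and bounded by `1 / c`: for
`z ∉ [0, ∞)` the operator `1 - (z + c) R` is invertible, and `(T - z)⁻¹ = R (1 - (z + c) R)⁻¹`. -/
theorem pmapSpectrum_subset_nonneg [CompleteSpace H] {T : H →ₗ.[ℂ] H} {c : ℝ} (hc : 0 < c)
    {R : H →L[ℂ] H} (hR : R.IsPositive) (hRc : ∀ y, c * ‖R y‖ ≤ ‖y‖)
    (hTR : ∀ y, ∃ u : T.domain, (u : H) = R y ∧ T u + (c : ℂ) • (u : H) = y)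
    (hRT : ∀ u : T.domain, R (T u + (c : ℂ) • (u : H)) = u) :
    pmapSpectrum T ⊆ {z : ℂ | ∃ r : ℝ, 0 ≤ r ∧ z = (r : ℂ)} := by
  intro z hz
  by_contra hzr
  apply hz
  simp only [Set.mem_ofPred_eq, not_exists, not_and] at hzr
  -- the numerical range of `1 - (z + c) R` stays away from `0`
  have hmin : ∃ δ : ℝ, 0 < δ ∧ ∀ ρ ∈ Set.Icc (0 : ℝ) (1 / c), δ ≤ ‖1 - (z + c) * (ρ : ℂ)‖ := by
    obtain ⟨ρ₀, hρ₀, hmin⟩ := (isCompact_Icc (a := (0 : ℝ)) (b := 1 / c)).exists_isMinOn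
      ⟨0, by simp [hc.le]⟩
      (f := fun ρ : ℝ => ‖1 - (z + c) * (ρ : ℂ)‖) (by fun_prop)
    refine ⟨_, norm_pos_iff.mpr ?_, fun ρ hρ => hmin hρ⟩
    intro h0
    have h1 : (z + c) * (ρ₀ : ℂ) = 1 := (sub_eq_zero.mp h0).symm
    have hne : ρ₀ ≠ 0 := by rintro rfl; simp at h1
    have hpos : 0 < ρ₀ := lt_of_le_of_ne hρ₀.1 hne.symm
    apply hzr (1 / ρ₀ - c)
    · have := hρ₀.2
      rw [sub_nonneg, le_div_iff₀ hpos]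
      rw [le_div_iff₀ hc] at this
      linarith
    · have hne' : (ρ₀ : ℂ) ≠ 0 := by exact_mod_cast hne
      push_cast
      field_simp
      linear_combination h1
  obtain ⟨δ, hδ, hmin⟩ := hmin
  have hunit : IsUnit ((1 : H →L[ℂ] H) - (z + c) • R) := by
    apply ContinuousLinearMap.isUnit_of_forall_le_norm_inner_map _ (c := ⟨δ, hδ.le⟩)
      (by exact_mod_cast hδ)
    intro x
    have hx : inner ℂ (((1 : H →L[ℂ] H) - (z + c) • R) x) x
        = starRingEnd ℂ ((‖x‖ ^ 2 : ℝ) - (z + c) * inner ℂ x (R x)) := by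
      rw [map_sub, map_mul, inner_conj_symm]
      simp only [sub_apply, one_apply_eq_self, smul_apply, inner_sub_left, inner_smul_left,
        inner_self_eq_norm_sq_to_K, Complex.conj_ofReal]
      push_cast
      rfl
    rw [hx, RCLike.norm_conj]
    rcases eq_or_ne x 0 with rfl | hx0
    · simp
    have hxp : 0 < ‖x‖ := norm_pos_iff.mpr hx0
    have h0 := hR.inner_nonneg_right x
    obtain ⟨s, hs⟩ : ∃ s : ℝ, inner ℂ x (R x) = (s : ℂ) :=
      ⟨_, (Complex.eq_re_of_ofReal_le (by simpa using h0 : ((0 : ℝ) : ℂ) ≤ _))⟩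
    have hs0 : 0 ≤ s := by rw [hs] at h0; exact_mod_cast h0
    have hs1 : c * s ≤ ‖x‖ ^ 2 := by
      have h1 : s ≤ ‖x‖ * ‖R x‖ := by
        have := norm_inner_le_norm (𝕜 := ℂ) x (R x)
        rw [hs, Complex.norm_real, Real.norm_eq_abs, abs_of_nonneg hs0] at this
        exact this
      have h2 := hRc x
      nlinarith
    have h3 := hmin (s / ‖x‖ ^ 2) ⟨by positivity, by
      rw [div_le_div_iff₀ (by positivity) hc]; linarith⟩
    have h4 : ((‖x‖ ^ 2 : ℝ) : ℂ) - (z + c) * inner ℂ x (R x)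
        = ((‖x‖ ^ 2 : ℝ) : ℂ) * (1 - (z + c) * ((s / ‖x‖ ^ 2 : ℝ) : ℂ)) := by
      have : (‖x‖ : ℂ) ≠ 0 := by exact_mod_cast hxp.ne'
      rw [hs]
      push_cast
      field_simp
    rw [h4, norm_mul, Complex.norm_real, Real.norm_eq_abs, abs_of_nonneg (by positivity)]
    exact mul_le_mul_of_nonneg_left h3 (by positivity)
  obtain ⟨v, hv⟩ := hunit
  set V : H →L[ℂ] H := ↑v⁻¹ with hV
  have hVl : ∀ y, V (y - (z + c) • R y) = y := by
    intro y
    have h : (V * (v : H →L[ℂ] H)) y = y := by rw [hV, Units.inv_mul]; rfl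
    rw [hv] at h
    simpa using h
  have hVr : ∀ y, V y - (z + c) • R (V y) = y := by
    intro y
    have h : ((v : H →L[ℂ] H) * V) y = y := by rw [hV, Units.mul_inv]; rfl
    rw [hv] at h
    simpa using h
  have hcomm : ∀ y, V (R y) = R (V y) := by
    intro y
    conv_lhs => rw [← hVr y]
    rw [map_sub, map_smul, hVl]
  refine ⟨R ∘L V, fun y => ?_, fun u => ?_⟩
  · obtain ⟨u, hu, hu'⟩ := hTR (V y)
    refine ⟨u, hu, ?_⟩
    have h5 : T u = V y - (c : ℂ) • (u : H) := by rw [← hu']; abel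
    refine Eq.trans ?_ (hVr y)
    rw [h5, hu, add_smul]
    abel
  · have h6 : R (T u - z • (u : H)) = (u : H) - (z + c) • R u := by
      have : T u - z • (u : H) = (T u + (c : ℂ) • (u : H)) - (z + c) • (u : H) := by
        rw [add_smul]; abel
      rw [this, map_sub, map_smul, hRT]
    rw [ContinuousLinearMap.comp_apply, ← hcomm, h6, hVl]


/-- Polarization: an operator whose quadratic form takes real values is symmetric. -/
theorem inner_map_symm_of_form_nonneg {T : H →ₗ.[ℂ] H}
    (hT : ∀ u : T.domain, 0 ≤ inner ℂ (u : H) (T u)) (x y : T.domain) :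
    inner ℂ (T x) (y : H) = inner ℂ (x : H) (T y) := by
  have im0 : ∀ u : T.domain, (inner ℂ (u : H) (T u)).im = 0 := fun u =>
    (Complex.le_def.mp (hT u)).2.symm
  have h1 := im0 (x + y)
  have h2 := im0 (x + Complex.I • y)
  have hx := im0 x
  have hy := im0 y
  rw [T.map_add, Submodule.coe_add, inner_add_left, inner_add_right, inner_add_right] at h1 h2
  rw [T.map_smul, Submodule.coe_smul, inner_smul_left, inner_smul_right, inner_smul_right,
    inner_smul_left] at h2
  simp [Complex.add_im, Complex.mul_im, Complex.mul_re, hx, hy] at h1 h2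
  rw [← inner_conj_symm]
  apply Complex.ext
  · simp only [Complex.conj_re]; linarith
  · simp only [Complex.conj_im]; linarith

theorem inner_eq_zero_of_eigenvalue_ne {T : H →ₗ.[ℂ] H}
    (hT : ∀ u : T.domain, 0 ≤ inner ℂ (u : H) (T u)) {ν ν' : ℝ} (hν : ν ≠ ν') {f g : H}
    (hf : IsEigenfunctionOrZero T ν f) (hg : IsEigenfunctionOrZero T ν' g) :
    inner ℂ f g = 0 := by
  obtain ⟨hf, hf'⟩ := hf
  obtain ⟨hg, hg'⟩ := hg
  have h := inner_map_symm_of_form_nonneg hT ⟨f, hf⟩ ⟨g, hg⟩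
  rw [hf', hg', inner_smul_left, inner_smul_right, Complex.conj_ofReal] at h
  have h2 : ((ν : ℂ) - ν') * inner ℂ f g = 0 := by linear_combination h
  rcases mul_eq_zero.mp h2 with h3 | h3
  · exact absurd (by exact_mod_cast sub_eq_zero.mp h3) hν
  · exact h3

/-- The lower half of the min-max principle: if `n + 1` eigenvalues of `T` are at most `μ`, then any
`n` linear conditions are satisfied by a trial vector `u ≠ 0` with `⟨u, T u⟩ ≤ μ ‖u‖²`. -/
theorem exists_form_le_of_mem_eigenvalueCountSet {T : H →ₗ.[ℂ] H}
    (hT : ∀ u : T.domain, 0 ≤ inner ℂ (u : H) (T u)) {n : ℕ} {μ : ℝ}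
    (hμ : μ ∈ eigenvalueCountSet T n) {ι : Type*} [Fintype ι] (hι : Fintype.card ι ≤ n)
    (ℓ : H →ₗ[ℂ] (ι → ℂ)) :
    ∃ u : T.domain, (u : H) ≠ 0 ∧ ℓ u = 0 ∧ (inner ℂ (u : H) (T u)).re ≤ μ * ‖(u : H)‖ ^ 2 := by
  obtain ⟨ν, φ, hφ, h⟩ := hμ
  have hdom : ∀ j, φ j ∈ T.domain := fun j => (h j).2.choose
  have hTφ : ∀ j, T ⟨φ j, hdom j⟩ = (ν j : ℂ) • φ j := fun j => (h j).2.choose_spec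
  have hker : LinearMap.ker (ℓ ∘ₗ Fintype.linearCombination ℂ φ) ≠ ⊥ := by
    apply LinearMap.ker_ne_bot_of_finrank_lt
    simp
    omega
  obtain ⟨a, ha, ha0⟩ := Submodule.exists_mem_ne_zero_of_ne_bot hker
  set w : Fin (n + 1) → T.domain := fun j => ⟨φ j, hdom j⟩ with hw
  have hu : ((∑ j, a j • w j : T.domain) : H) = ∑ j, a j • φ j := by simp [hw]
  have hTu : T (∑ j, a j • w j) = ∑ j, (a j * ν j) • φ j := by
    rw [← LinearPMap.toFun_eq_coe, map_sum]
    refine Finset.sum_congr rfl fun j _ => ?_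
    rw [map_smul, LinearPMap.toFun_eq_coe, hTφ, smul_smul]
  refine ⟨∑ j, a j • w j, ?_, ?_, ?_⟩
  · rw [hu]
    intro h0
    exact ha0 (funext (Fintype.linearIndependent_iff.mp hφ a h0))
  · rw [hu]
    simpa [Fintype.linearCombination_apply] using ha
  · -- `μ ‖u‖² - ⟨u, T u⟩` is the square of the norm of `∑ √(μ - ν j) a j φ j`
    set p : H := ∑ j, (a j * (√(μ - ν j) : ℝ)) • φ j with hp
    have key : inner ℂ p p = (μ : ℂ) * inner ℂ (∑ j, a j • φ j) (∑ j, a j • φ j)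
        - inner ℂ (∑ j, a j • φ j) (∑ j, (a j * ν j) • φ j) := by
      rw [hp]
      simp only [sum_inner, inner_sum, inner_smul_left, inner_smul_right, Finset.mul_sum,
        ← Finset.sum_sub_distrib]
      refine Finset.sum_congr rfl fun j _ => Finset.sum_congr rfl fun i _ => ?_
      by_cases hij : ν i = ν j
      · have hsq : ((√(μ - ν j) : ℝ) : ℂ) * ((√(μ - ν j) : ℝ) : ℂ) = μ - ν j := by
          rw [← Complex.ofReal_mul, Real.mul_self_sqrt (by linarith [(h j).1])]
          push_cast; rfl
        simp only [map_mul, Complex.conj_ofReal, hij]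
        linear_combination (a j * (starRingEnd ℂ) (a i) * inner ℂ (φ i) (φ j)) * hsq
      · rw [inner_eq_zero_of_eigenvalue_ne hT hij (h i).2 (h j).2]
        ring
    have hpos : 0 ≤ (inner ℂ p p).re := inner_self_nonneg (𝕜 := ℂ)
    rw [key, Complex.sub_re, Complex.re_ofReal_mul] at hpos
    have hn : (inner ℂ (∑ j, a j • φ j) (∑ j, a j • φ j) : ℂ).re = ‖∑ j, a j • φ j‖ ^ 2 := by
      rw [inner_self_eq_norm_sq_to_K]; norm_cast
    rw [hu, hTu]
    rw [hn] at hpos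
    linarith

theorem eigenvalue_nonneg {T : H →ₗ.[ℂ] H}
    (hT : ∀ u : T.domain, 0 ≤ inner ℂ (u : H) (T u)) {n : ℕ} {μ : ℝ}
    (hμ : μ ∈ eigenvalueCountSet T n) : 0 ≤ μ := by
  obtain ⟨u, hu0, -, hu⟩ := exists_form_le_of_mem_eigenvalueCountSet hT hμ (ι := Empty)
    (by simp) 0
  have h1 := (Complex.le_def.mp (hT u)).1
  have h2 : 0 < ‖(u : H)‖ := norm_pos_iff.mpr hu0
  simp only [Complex.zero_re] at h1
  by_contra hneg
  nlinarith [mul_pos (neg_pos.mpr (not_le.mp hneg)) (pow_pos h2 2)]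

/-- If fewer than `n + 1` eigenvalues, counted with multiplicity, are at most `M`, then only
finitely many distinct real numbers below `M` are eigenvalues: eigenfunctions of different
eigenvalues are orthogonal, hence independent. -/
theorem finite_eigenvalues_le {T : H →ₗ.[ℂ] H}
    (hT : ∀ u : T.domain, 0 ≤ inner ℂ (u : H) (T u)) {n : ℕ} {M : ℝ}
    (hM : M ∉ eigenvalueCountSet T n) :
    {ν : ℝ | ν ≤ M ∧ ∃ f : H, f ≠ 0 ∧ IsEigenfunctionOrZero T ν f}.Finite := by
  by_contra hinf
  have hinf : Set.Infinite _ := hinf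
  let e := hinf.natEmbedding
  let ν : Fin (n + 1) → ℝ := fun j => (e j : ℝ)
  have hν : Function.Injective ν := by
    intro i j hij
    exact Fin.val_injective (e.injective (Subtype.ext hij))
  choose f hf0 hf using fun j : Fin (n + 1) => (e j).2.2
  refine hM ⟨ν, f, ?_, fun j => ⟨(e j).2.1, hf j⟩⟩
  exact linearIndependent_of_ne_zero_of_inner_eq_zero hf0
    fun i j hij => inner_eq_zero_of_eigenvalue_ne hT (hν.ne hij) (hf i) (hf j)

/-- The infimum defining the `n`-th eigenvalue is attained as soon as there are at least `n + 1`
eigenvalues and only finitely many of them lie below any given bound. -/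
theorem isLeast_nthEigenvalue {T : H →ₗ.[ℂ] H}
    (hT : ∀ u : T.domain, 0 ≤ inner ℂ (u : H) (T u)) {n : ℕ}
    (hne : (eigenvalueCountSet T n).Nonempty) (hfin : ∀ M, ∃ m, M ∉ eigenvalueCountSet T m) :
    IsLeast (eigenvalueCountSet T n) (nthEigenvalue T n) := by
  have hbdd : BddBelow (eigenvalueCountSet T n) := ⟨0, fun μ hμ => eigenvalue_nonneg hT hμ⟩
  refine ⟨?_, fun μ hμ => csInf_le hbdd hμ⟩
  set μ₀ := nthEigenvalue T n with hμ₀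
  obtain ⟨m, hm⟩ := hfin (μ₀ + 1)
  set E := {ν : ℝ | ν ≤ μ₀ + 1 ∧ ∃ f : H, f ≠ 0 ∧ IsEigenfunctionOrZero T ν f}
  have hE : E.Finite := finite_eigenvalues_le hT hm
  -- no eigenvalue lies in `(μ₀, μ₁)`
  obtain ⟨μ₁, hμ₁, hgap⟩ : ∃ μ₁, μ₀ < μ₁ ∧ ∀ ν ∈ E, ν < μ₁ → ν ≤ μ₀ := by
    have hE' : (E ∩ Set.Ioi μ₀).Finite := hE.inter_of_left _
    have hnhds : (E ∩ Set.Ioi μ₀)ᶜ ∈ nhds μ₀ :=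
      hE'.isClosed.isOpen_compl.mem_nhds (by simp)
    obtain ⟨μ₁, h1, h2⟩ := exists_Ico_subset_of_mem_nhds hnhds ⟨μ₀ + 1, by linarith⟩
    refine ⟨μ₁, h1, fun ν hν hlt => ?_⟩
    by_contra hgt
    push Not at hgt
    exact h2 ⟨hgt.le, hlt⟩ ⟨hν, hgt⟩
  obtain ⟨μ, hμ, hlt⟩ := exists_lt_of_csInf_lt hne
    (show sInf (eigenvalueCountSet T n) < min μ₁ (μ₀ + 1) from
      lt_min hμ₁ (by change μ₀ < μ₀ + 1; linarith))
  obtain ⟨ν, φ, hφ, h⟩ := hμ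
  refine ⟨ν, φ, hφ, fun j => ⟨?_, (h j).2⟩⟩
  exact hgap _ ⟨((h j).1.trans hlt.le).trans (min_le_right _ _), φ j, hφ.ne_zero j, (h j).2⟩
    (((h j).1.trans_lt hlt).trans_le (min_le_left _ _))

/-- An operator with compact positive resolvent on an infinite-dimensional space has infinitely many
eigenvalues, counted with multiplicity, by the spectral theorem for compact operators: a nonzero
eigenvalue `κ` of the resolvent gives the eigenvalue `κ⁻¹ - c` of `T`. -/
theorem eigenvalueCountSet_nonempty [CompleteSpace H] (hH : ¬ FiniteDimensional ℂ H)
    {T : H →ₗ.[ℂ] H} {c : ℝ} {R : H →L[ℂ] H} (hR : R.IsPositive) (hRk : IsCompactOperator R)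
    (hTR : ∀ y, ∃ u : T.domain, (u : H) = R y ∧ T u + (c : ℂ) • (u : H) = y) (n : ℕ) :
    (eigenvalueCountSet T n).Nonempty := by
  set s : Set H := {f | ∃ ν, IsEigenfunctionOrZero T ν f} with hs
  have hle : (⨆ κ, Module.End.eigenspace (R : Module.End ℂ H) κ) ≤ Submodule.span ℂ s := by
    refine iSup_le fun κ f hf => Submodule.subset_span ?_
    have hRf : R f = κ • f := by
      rw [Module.End.mem_eigenspace_iff] at hf
      exact hf
    obtain ⟨u, hu, hu'⟩ := hTR f
    rw [hRf] at hu
    -- `f = 0` is an eigenfunction or zero for every `ν`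
    rcases eq_or_ne f 0 with rfl | hf0
    · exact ⟨0, T.domain.zero_mem, T.map_zero.trans (smul_zero _).symm⟩
    have hκ : κ ≠ 0 := by
      rintro rfl
      rw [zero_smul] at hu
      have : u = 0 := Subtype.ext hu
      rw [this, T.map_zero] at hu'
      exact hf0 (by simpa using hu'.symm)
    have hreal : (starRingEnd ℂ) κ = κ := by
      refine LinearMap.IsSymmetric.conj_eigenvalue_eq_self (T := (R : H →ₗ[ℂ] H)) hR.isSymmetric ?_
      exact Module.End.hasEigenvalue_of_hasEigenvector ⟨hf, hf0⟩
    obtain ⟨k, rfl⟩ : ∃ k : ℝ, κ = (k : ℂ) := ⟨κ.re, (Complex.conj_eq_iff_re.mp hreal).symm⟩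
    have hfu : f = (k : ℂ)⁻¹ • (u : H) := by rw [hu, smul_smul, inv_mul_cancel₀ hκ, one_smul]
    refine ⟨k⁻¹ - c, hfu ▸ T.domain.smul_mem _ u.2, ?_⟩
    have h1 : (⟨f, hfu ▸ T.domain.smul_mem _ u.2⟩ : T.domain) = (k : ℂ)⁻¹ • u := Subtype.ext hfu
    have h2 : T u = f - (c : ℂ) • (u : H) := by rw [← hu']; abel
    rw [h1, T.map_smul, h2, hu, smul_sub, smul_smul, smul_smul]
    push_cast
    rw [sub_smul]
    congr 2
    field_simp
  obtain ⟨b, hbs, hbspan, hb⟩ := exists_linearIndependent ℂ s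
  have hbinf : b.Infinite := by
    intro hfin
    apply hH
    have hfd : FiniteDimensional ℂ (Submodule.span ℂ s) := by
      rw [← hbspan]; exact FiniteDimensional.span_of_finite ℂ hfin
    have horth : (Submodule.span ℂ s)ᗮ = ⊥ := by
      rw [eq_bot_iff, ← ContinuousLinearMap.orthogonalComplement_iSup_eigenspaces_eq_bot hRk
        hR.isSymmetric]
      exact Submodule.orthogonal_le hle
    rw [Submodule.orthogonal_eq_bot_iff] at horth
    rw [horth] at hfd
    exact Module.Finite.equiv (Submodule.topEquiv (R := ℂ) (M := H))
  let e := hbinf.natEmbedding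
  choose ν hν using fun j : Fin (n + 1) => hbs (e j).2
  obtain ⟨M, hM⟩ := (Set.finite_range ν).bddAbove
  refine ⟨M, ν, fun j => (e j : H), ?_, fun j => ⟨hM ⟨j, rfl⟩, hν j⟩⟩
  exact hb.comp (fun j : Fin (n + 1) => e j) (e.injective.comp Fin.val_injective)

end UnboundedTheory

/-! ### Coercivity of the Jacobi form -/

section JacobiForm

theorem mul_mul_le_of_sq_le {r A B x y : ℝ} (hA : 0 ≤ A) (hB : 0 ≤ B) (h : r ^ 2 ≤ 4 * (A * B)) :
    r * (x * y) ≤ A * x ^ 2 + B * y ^ 2 := by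
  apply le_of_sq_le_sq _ (by positivity)
  have h1 : r ^ 2 * (x * y) ^ 2 ≤ 4 * (A * B) * (x * y) ^ 2 := by gcongr
  nlinarith [sq_nonneg (A * x ^ 2 - B * y ^ 2)]

/-- The two sides differ by `(r² + s (s + 1))²`. Equality is possible, so that splitting every
diagonal entry evenly between its two neighbours would only give nonnegativity of the form. -/
theorem sq_le_mul_shift (s r : ℝ) : r ^ 2 ≤ (s ^ 2 + r ^ 2) * ((s + 1) ^ 2 + r ^ 2) := by
  nlinarith [sq_nonneg (r ^ 2 + s * (s + 1))]

theorem sq_le_mul_shift_of_le {s r : ℝ} (hs : 1 / 2 ≤ s) :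
    5 / 2 * r ^ 2 ≤ (s ^ 2 + r ^ 2) * ((s + 1) ^ 2 + r ^ 2) := by
  nlinarith [sq_nonneg (r ^ 2 + s * (s + 1)), sq_nonneg r, mul_nonneg (sq_nonneg r)
    (by nlinarith : 0 ≤ s * (s + 1) - 3 / 4)]

/-- The diagonal `(k + t)² + r²` of the fibre operator in Fourier coefficients, where `t = ξ₁` and
`r` is the length of the remaining components of `ξ`. -/
noncomputable def fibreSymbol (t r : ℝ) (k : ℤ) : ℝ := (k + t) ^ 2 + r ^ 2

theorem fibreSymbol_nonneg (t r : ℝ) (k : ℤ) : 0 ≤ fibreSymbol t r k := by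
  unfold fibreSymbol; positivity

/-- The share of the diagonal entry at `k` that is spent on the pair `(k, k + 1)`; the rest goes to
the pair `(k - 1, k)`. The mode `m` splits evenly, the other modes give the share `3 / 4` to the
side of `m`. -/
noncomputable def pairWeight (m k : ℤ) : ℝ :=
  if m < k then 1 / 4 else if k = m then 1 / 2 else 3 / 4

theorem pairWeight_mem (m k : ℤ) : 0 ≤ pairWeight m k ∧ pairWeight m k ≤ 1 := by
  unfold pairWeight; split_ifs <;> norm_num

/-- The interaction of two neighbouring modes is dominated by nine tenths of their shares of the
diagonal, if `m` is a mode nearest to `-t`. Two pairs meet `m`, and for them `4 · (1/2) · (3/4)`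
leaves room in `sq_le_mul_shift`; for all other pairs the factor `4 · (1/4) · (3/4)` is made up for
by the larger diagonal in `sq_le_mul_shift_of_le`. -/
theorem pair_le {t r : ℝ} {m : ℤ} (hm : |m + t| ≤ 1 / 2) (k : ℤ) (x y : ℝ) :
    r * (x * y) ≤ 9 / 10 * (pairWeight m k * (fibreSymbol t r k * x ^ 2) +
      (1 - pairWeight m (k + 1)) * (fibreSymbol t r (k + 1) * y ^ 2)) := by
  have hd := fibreSymbol_nonneg t r k
  have hd' := fibreSymbol_nonneg t r (k + 1)
  have hα := (pairWeight_mem m k).1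
  have hβ := (pairWeight_mem m (k + 1)).2
  have hprod : r ^ 2 ≤ 4 * (9 / 10 * pairWeight m k * fibreSymbol t r k *
      (9 / 10 * (1 - pairWeight m (k + 1)) * fibreSymbol t r (k + 1))) := by
    have h0 : r ^ 2 ≤ fibreSymbol t r k * fibreSymbol t r (k + 1) := by
      unfold fibreSymbol
      push_cast
      have := sq_le_mul_shift (k + t) r
      rwa [add_right_comm] at this
    obtain ⟨hm1, hm2⟩ := abs_le.mp hm
    have hr := sq_nonneg r
    rcases lt_trichotomy k m with h | h | h
    · rcases eq_or_lt_of_le (Int.add_one_le_iff.mpr h) with h' | h'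
      · have h1 : pairWeight m k = 3 / 4 := by
          unfold pairWeight; rw [if_neg (by omega), if_neg (by omega)]
        have h2 : pairWeight m (k + 1) = 1 / 2 := by
          unfold pairWeight; rw [if_neg (by omega), if_pos h']
        rw [h1, h2]
        linarith
      · have h1 : pairWeight m k = 3 / 4 := by
          unfold pairWeight; rw [if_neg (by omega), if_neg (by omega)]
        have h2 : pairWeight m (k + 1) = 3 / 4 := by
          unfold pairWeight; rw [if_neg (by omega), if_neg (by omega)]
        have h3 : (k : ℝ) + 2 ≤ m := by exact_mod_cast (by omega : k + 2 ≤ m)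
        have h4 := sq_le_mul_shift_of_le (s := -(k + 1 + t)) (r := r) (by linarith)
        have h5 : 5 / 2 * r ^ 2 ≤ fibreSymbol t r k * fibreSymbol t r (k + 1) := by
          unfold fibreSymbol
          push_cast
          linarith
        rw [h1, h2]
        linarith
    · have h1 : pairWeight m k = 1 / 2 := by
        unfold pairWeight; rw [if_neg (by omega), if_pos h]
      have h2 : pairWeight m (k + 1) = 1 / 4 := by
        unfold pairWeight; rw [if_pos (by omega)]
      rw [h1, h2]
      linarith
    · have h1 : pairWeight m k = 1 / 4 := by
        unfold pairWeight; rw [if_pos h]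
      have h2 : pairWeight m (k + 1) = 1 / 4 := by
        unfold pairWeight; rw [if_pos (by omega)]
      have h3 : (m : ℝ) + 1 ≤ k := by exact_mod_cast (by omega : m + 1 ≤ k)
      have h4 := sq_le_mul_shift_of_le (s := k + t) (r := r) (by linarith)
      have h5 : 5 / 2 * r ^ 2 ≤ fibreSymbol t r k * fibreSymbol t r (k + 1) := by
        unfold fibreSymbol
        push_cast
        linarith
      rw [h1, h2]
      linarith
  have := mul_mul_le_of_sq_le (x := x) (y := y) (by positivity)
    (mul_nonneg (mul_nonneg (by norm_num) (by linarith)) hd') hprod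
  linarith

theorem abs_round_neg_add_le (t : ℝ) : |(round (-t) : ℤ) + t| ≤ 1 / 2 := by
  have := abs_sub_round (-t)
  rwa [show ((round (-t) : ℤ) : ℝ) + t = -(-t - round (-t)) by ring, abs_neg]

/-- The interaction of neighbouring modes is at most nine tenths of the diagonal part. -/
theorem tsum_mul_shift_le {t r : ℝ} {b : ℤ → ℝ}
    (hb : Summable fun k => fibreSymbol t r k * b k ^ 2)
    (hs : Summable fun k => b k * b (k + 1)) :
    r * ∑' k, b k * b (k + 1) ≤ 9 / 10 * ∑' k, fibreSymbol t r k * b k ^ 2 := by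
  set m := round (-t)
  have hm := abs_round_neg_add_le t
  have h1 : Summable fun k => pairWeight m k * (fibreSymbol t r k * b k ^ 2) :=
    hb.of_nonneg_of_le
      (fun k => mul_nonneg (pairWeight_mem m k).1
        (mul_nonneg (fibreSymbol_nonneg t r k) (sq_nonneg _)))
      (fun k => mul_le_of_le_one_left (mul_nonneg (fibreSymbol_nonneg t r k) (sq_nonneg _))
        (pairWeight_mem m k).2)
  have h2 : Summable fun k => (1 - pairWeight m k) * (fibreSymbol t r k * b k ^ 2) := by
    simpa [sub_mul] using hb.sub h1
  have h2' : Summable fun k : ℤ =>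
      (1 - pairWeight m (k + 1)) * (fibreSymbol t r (k + 1) * b (k + 1) ^ 2) :=
    (Equiv.addRight (1 : ℤ)).summable_iff.mpr h2
  have hshift : ∑' k : ℤ,
      (1 - pairWeight m (k + 1)) * (fibreSymbol t r (k + 1) * b (k + 1) ^ 2)
      = ∑' k, (1 - pairWeight m k) * (fibreSymbol t r k * b k ^ 2) :=
    (Equiv.addRight (1 : ℤ)).tsum_eq (fun k => (1 - pairWeight m k) * (fibreSymbol t r k * b k ^ 2))
  calc r * ∑' k, b k * b (k + 1) = ∑' k, r * (b k * b (k + 1)) := tsum_mul_left.symm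
    _ ≤ ∑' k, 9 / 10 * (pairWeight m k * (fibreSymbol t r k * b k ^ 2) +
      (1 - pairWeight m (k + 1)) * (fibreSymbol t r (k + 1) * b (k + 1) ^ 2)) :=
        (hs.mul_left r).tsum_le_tsum (fun k => pair_le hm k _ _) ((h1.add h2').mul_left _)
    _ = 9 / 10 * ∑' k, fibreSymbol t r k * b k ^ 2 := by
        rw [tsum_mul_left, h1.tsum_add h2', hshift, ← h1.tsum_add h2]
        congr 2
        funext k
        ring

end JacobiForm

/-! ### Multiplication operators on `L²` -/

section MultiplicationOperators

variable {α : Type*} [MeasurableSpace α] {μ : Measure α} {b : α → ℂ}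

theorem coeFn_mulL2 (hb : MemLp b ∞ μ) (u : Lp ℂ 2 μ) :
    mulL2 μ b hb u =ᵐ[μ] fun x => b x * u x := by
  filter_upwards [Lp.coeFn_lpSMul (r := 2) (hb.toLp b) u, hb.coeFn_toLp] with x h1 h2
  change (hb.toLp b • u : Lp ℂ 2 μ) x = _
  rw [h1, Pi.smul_apply', h2, smul_eq_mul]

theorem norm_mulL2_le (hb : MemLp b ∞ μ) {C : ℝ} (h : ∀ x, ‖b x‖ ≤ C) (u : Lp ℂ 2 μ) :
    ‖mulL2 μ b hb u‖ ≤ C * ‖u‖ := by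
  refine Lp.norm_le_mul_norm_of_ae_le_mul ?_
  filter_upwards [coeFn_mulL2 hb u] with x hx
  rw [hx, norm_mul]
  gcongr
  exact h x

/-- `mulL2` as a bounded operator, for a function bounded by `C` everywhere. -/
noncomputable def mulL2CLM (hb : MemLp b ∞ μ) {C : ℝ} (h : ∀ x, ‖b x‖ ≤ C) :
    Lp ℂ 2 μ →L[ℂ] Lp ℂ 2 μ :=
  (mulL2 μ b hb).mkContinuous C (norm_mulL2_le hb h)

end MultiplicationOperators

/-! ### Fourier coefficients and Fourier multipliers on the circle -/

section FourierCoefficients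

/-- Parseval's identity. -/
theorem hasSum_conj_circleCoeff_mul (u v : L2Circle) :
    HasSum (fun k => starRingEnd ℂ (circleCoeff u k) * circleCoeff v k) (inner ℂ u v) := by
  have h := lp.hasSum_inner (𝕜 := ℂ) ((fourierBasis (T := 2 * Real.pi)).repr u)
    ((fourierBasis (T := 2 * Real.pi)).repr v)
  rw [LinearIsometryEquiv.inner_map_map] at h
  refine h.congr_fun fun k => ?_
  rw [fourierBasis_repr, fourierBasis_repr, RCLike.inner_apply, mul_comm]
  rfl

theorem hasSum_sq_circleCoeff (u : L2Circle) :
    HasSum (fun k => ‖circleCoeff u k‖ ^ 2) (‖u‖ ^ 2) := by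
  have h := hasSum_conj_circleCoeff_mul u u
  rw [inner_self_eq_norm_sq_to_K] at h
  rw [← Complex.hasSum_ofReal]
  convert h using 2 with k
  · rw [← Complex.normSq_eq_conj_mul_self, Complex.normSq_eq_norm_sq]
  · norm_cast

theorem norm_le_of_circleCoeff_le {u v : L2Circle} {C : ℝ} (hC : 0 ≤ C)
    (h : ∀ k, ‖circleCoeff v k‖ ≤ C * ‖circleCoeff u k‖) : ‖v‖ ≤ C * ‖u‖ := by
  refine le_of_sq_le_sq ?_ (by positivity)
  rw [mul_pow]
  refine hasSum_le (fun k => ?_) (hasSum_sq_circleCoeff v) ((hasSum_sq_circleCoeff u).mul_left _)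
  rw [← mul_pow]
  gcongr
  exact h k

/-- The Riesz–Fischer theorem, for sequences dominated by the Fourier coefficients of some `u`. -/
theorem exists_circleCoeff_eq {u : L2Circle} {b : ℤ → ℂ} {C : ℝ}
    (h : ∀ k, ‖b k‖ ≤ C * ‖circleCoeff u k‖) : ∃ v : L2Circle, circleCoeff v = b := by
  have hmem : Memℓp b 2 := by
    apply memℓp_gen
    have hs := (hasSum_sq_circleCoeff u).summable.mul_left (C ^ 2)
    refine hs.of_nonneg_of_le (fun k => by positivity) fun k => ?_
    rw [← mul_pow]
    simp only [ENNReal.toReal_ofNat, Real.rpow_ofNat]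
    gcongr
    exact h k
  refine ⟨(fourierBasis (T := 2 * Real.pi)).repr.symm ⟨b, hmem⟩, ?_⟩
  funext k
  change fourierCoeff _ k = _
  rw [← fourierBasis_repr, LinearIsometryEquiv.apply_symm_apply]

theorem exists_fourierMultiplier {m : ℤ → ℂ} {C : ℝ} (hC : 0 ≤ C) (hm : ∀ k, ‖m k‖ ≤ C) :
    ∃ G : L2Circle →L[ℂ] L2Circle, ‖G‖ ≤ C ∧
      ∀ u k, circleCoeff (G u) k = m k * circleCoeff u k := by
  have hle : ∀ u k, ‖m k * circleCoeff u k‖ ≤ C * ‖circleCoeff u k‖ := fun u k => by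
    rw [norm_mul]
    gcongr
    exact hm k
  choose G hG using fun u => exists_circleCoeff_eq (hle u)
  have hG' : ∀ u k, circleCoeff (G u) k = m k * circleCoeff u k := fun u k => congrFun (hG u) k
  refine ⟨LinearMap.mkContinuous
    { toFun := G
      map_add' := fun u v => circleCoeff_injective (by
        funext k; simp only [map_add, Pi.add_apply, hG', mul_add])
      map_smul' := fun c u => circleCoeff_injective (by
        funext k
        simp only [map_smul, Pi.smul_apply, hG', smul_eq_mul, RingHom.id_apply]; ring) } C
    fun u => norm_le_of_circleCoeff_le hC fun k => ?_, LinearMap.mkContinuous_norm_le _ hC _, hG'⟩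
  change ‖circleCoeff (G u) k‖ ≤ _
  rw [hG']
  exact hle u k

theorem circleCoeff_fourierBasis (j k : ℤ) :
    circleCoeff (fourierBasis (T := 2 * Real.pi) j) k = if k = j then 1 else 0 := by
  change fourierCoeff _ k = _
  rw [← fourierBasis_repr, HilbertBasis.repr_self, lp.single_apply]
  by_cases h : k = j
  · subst h; simp
  · simp [h]

/-- A Fourier multiplier whose symbol tends to zero is the norm limit of operators of finite rank,
hence compact. -/
theorem isCompactOperator_of_fourierMultiplier {m : ℤ → ℂ} {G : L2Circle →L[ℂ] L2Circle}
    (hG : ∀ u k, circleCoeff (G u) k = m k * circleCoeff u k)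
    (hm : ∀ ε > 0, ∃ F : Finset ℤ, ∀ k ∉ F, ‖m k‖ ≤ ε) : IsCompactOperator G := by
  have hclosed := isClosed_setOfPred_isCompactOperator (𝕜₁ := ℂ) (𝕜₂ := ℂ) (σ₁₂ := RingHom.id ℂ)
    (M₁ := L2Circle) (M₂ := L2Circle)
  suffices h : G ∈ closure {f : L2Circle →L[ℂ] L2Circle | IsCompactOperator f} by
    rwa [hclosed.closure_eq] at h
  rw [Metric.mem_closure_iff]
  intro ε hε
  obtain ⟨F, hF⟩ := hm (ε / 2) (by positivity)
  set P : L2Circle →L[ℂ] L2Circle := ∑ j ∈ F, m j •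
    (ContinuousLinearMap.toSpanSingleton ℂ (fourierBasis (T := 2 * Real.pi) j)).comp
      (innerSL ℂ (fourierBasis (T := 2 * Real.pi) j)) with hP
  have hPc : IsCompactOperator P := by
    rw [hP]
    refine Submodule.sum_mem (compactOperator (RingHom.id ℂ) L2Circle L2Circle) fun j _ => ?_
    refine Submodule.smul_mem _ _ ?_
    have hinner : IsCompactOperator (innerSL ℂ (fourierBasis (T := 2 * Real.pi) j)) :=
      isCompactOperator_of_locallyCompactSpace_dom _
    exact hinner.clm_comp
      (ContinuousLinearMap.toSpanSingleton ℂ (fourierBasis (T := 2 * Real.pi) j))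
  have hPcoeff : ∀ u k, circleCoeff (P u) k = if k ∈ F then m k * circleCoeff u k else 0 := by
    intro u k
    have hj : ∀ j, inner ℂ (fourierBasis (T := 2 * Real.pi) j) u = circleCoeff u j := fun j => by
      rw [← HilbertBasis.repr_apply_apply, fourierBasis_repr]; rfl
    simp only [hP, sum_apply, map_sum, Finset.sum_apply, smul_apply,
      ContinuousLinearMap.comp_apply, innerSL_apply_apply, hj,
      ContinuousLinearMap.toSpanSingleton_apply, map_smul, Pi.smul_apply, smul_eq_mul,
      circleCoeff_fourierBasis, mul_ite, mul_one, mul_zero, Finset.sum_ite_eq]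
  refine ⟨P, hPc, ?_⟩
  rw [dist_eq_norm]
  refine lt_of_le_of_lt (ContinuousLinearMap.opNorm_le_bound _ (by positivity : 0 ≤ ε / 2)
    fun u => norm_le_of_circleCoeff_le (by positivity) fun k => ?_) (half_lt_self hε)
  rw [sub_apply, map_sub, Pi.sub_apply, hG, hPcoeff]
  split_ifs with hk
  · simp; positivity
  · rw [sub_zero, norm_mul]
    gcongr
    exact hF k hk

theorem not_finiteDimensional_L2Circle : ¬ FiniteDimensional ℂ L2Circle := by
  intro h
  have := (fourierBasis (T := 2 * Real.pi)).orthonormal.linearIndependent.finite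
  exact not_finite ℤ

/-- A real trigonometric polynomial of degree one acts on Fourier coefficients by coupling nearest
neighbours. -/
theorem circleCoeff_mulL2_of_eq {b : AddCircle (2 * Real.pi) → ℂ} (hb : MemLp b ∞ _) {w : ℂ}
    (h : ∀ x, b x = w * fourier 1 x + starRingEnd ℂ w * fourier (-1) x) (u : L2Circle) (k : ℤ) :
    circleCoeff (mulL2 AddCircle.haarAddCircle b hb u) k
      = w * circleCoeff u (k - 1) + starRingEnd ℂ w * circleCoeff u (k + 1) := by
  have hint : ∀ n : ℤ, Integrable (fun x => fourier n x * u x)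
      (AddCircle.haarAddCircle : Measure (AddCircle (2 * Real.pi))) := by
    intro n
    have hu : Integrable u (AddCircle.haarAddCircle : Measure (AddCircle (2 * Real.pi))) :=
      (Lp.memLp u).integrable (by norm_num)
    refine hu.bdd_mul (c := 1) (ContinuousMap.continuous _).aestronglyMeasurable ?_
    exact Filter.Eventually.of_forall fun x => (Circle.norm_coe _).le
  change fourierCoeff _ k = w * fourierCoeff u (k - 1) + starRingEnd ℂ w * fourierCoeff u (k + 1)
  simp only [fourierCoeff, smul_eq_mul]
  rw [← integral_const_mul, ← integral_const_mul,
    ← integral_add ((hint _).const_mul _) ((hint _).const_mul _)]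
  refine integral_congr_ae ?_
  filter_upwards [coeFn_mulL2 hb u] with x hx
  rw [hx, h, show -(k - 1) = -k + 1 by ring, show -(k + 1) = -k + -1 by ring, fourier_add,
    fourier_add]
  ring

end FourierCoefficients

/-! ### The fibre operators -/

section FibreOperator

open scoped ComplexOrder

variable {d : ℕ} [NeZero d]

theorem fourier_one_two_pi (x : ℝ) :
    fourier 1 (x : AddCircle (2 * Real.pi)) = Complex.exp (x * Complex.I) := by
  rw [fourier_coe_apply]
  congr 1
  have : (Real.pi : ℂ) ≠ 0 := by exact_mod_cast Real.pi_ne_zero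
  push_cast
  field_simp

theorem fourier_neg_one_two_pi (x : ℝ) :
    fourier (-1) (x : AddCircle (2 * Real.pi)) = Complex.exp (-x * Complex.I) := by
  rw [fourier_coe_apply]
  congr 1
  have : (Real.pi : ℂ) ≠ 0 := by exact_mod_cast Real.pi_ne_zero
  push_cast
  field_simp

/-- The Euclidean norm `|ξ'|` of `ξ' = (ξ₂, …, ξ_d)`. -/
noncomputable def transverseNorm (ξ : EuclideanSpace ℝ (Fin d)) : ℝ :=
  √(∑ j ∈ Finset.univ.erase (0 : Fin d), ξ j ^ 2)

theorem transverseNorm_nonneg (ξ : EuclideanSpace ℝ (Fin d)) : 0 ≤ transverseNorm ξ :=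
  Real.sqrt_nonneg _

theorem norm_sq_eq_add_transverseNorm_sq (ξ : EuclideanSpace ℝ (Fin d)) :
    ‖ξ‖ ^ 2 = ξ 0 ^ 2 + transverseNorm ξ ^ 2 := by
  rw [transverseNorm, Real.sq_sqrt (Finset.sum_nonneg fun j _ => sq_nonneg _),
    EuclideanSpace.real_norm_sq_eq, Finset.add_sum_erase _ (fun j => ξ j ^ 2) (Finset.mem_univ _)]

/-- The potential is a real trigonometric polynomial of degree one with amplitude `|ξ'|`. -/
theorem exists_fibrePotential_eq (hd : d = 2 ∨ d = 3) (ξ : EuclideanSpace ℝ (Fin d)) :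
    ∃ w : ℂ, 2 * ‖w‖ = transverseNorm ξ ∧ ∀ x, (fibrePotential ξ x : ℂ) =
      w * fourier 1 x + starRingEnd ℂ w * fourier (-1) x := by
  rcases hd with rfl | rfl
  · refine ⟨(ξ 1 / 2 : ℝ), ?_, fun x => ?_⟩
    · have h : transverseNorm ξ ^ 2 = ξ 1 ^ 2 := by
        have := norm_sq_eq_add_transverseNorm_sq ξ
        rw [EuclideanSpace.real_norm_sq_eq, Fin.sum_univ_two] at this
        linarith
      refine (sq_eq_sq₀ (by positivity) (transverseNorm_nonneg ξ)).mp ?_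
      rw [h, mul_pow, Complex.norm_real, Real.norm_eq_abs, sq_abs]
      ring
    · induction x using QuotientAddGroup.induction_on with
      | H x =>
        rw [fourier_one_two_pi, fourier_neg_one_two_pi, fibrePotential, Fin.sum_univ_two]
        simp only [Function.Periodic.lift_coe, Fin.val_zero, Fin.val_one, helixCoeff,
          Complex.conj_ofReal]
        push_cast
        rw [Complex.cos]
        ring
  · refine ⟨(ξ 1 / 2 : ℝ) - (ξ 2 / 2 : ℝ) * Complex.I, ?_, fun x => ?_⟩
    · have h : transverseNorm ξ ^ 2 = ξ 1 ^ 2 + ξ 2 ^ 2 := by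
        have := norm_sq_eq_add_transverseNorm_sq ξ
        rw [EuclideanSpace.real_norm_sq_eq, Fin.sum_univ_three] at this
        linarith
      refine (sq_eq_sq₀ (by positivity) (transverseNorm_nonneg ξ)).mp ?_
      rw [h, mul_pow, ← Complex.normSq_eq_norm_sq, Complex.normSq_apply]
      simp
      ring
    · induction x using QuotientAddGroup.induction_on with
      | H x =>
        rw [fourier_one_two_pi, fourier_neg_one_two_pi, fibrePotential, Fin.sum_univ_three]
        simp only [Function.Periodic.lift_coe, Fin.val_zero, Fin.val_one, Fin.val_two, helixCoeff,
          Complex.conj_ofReal, map_sub, map_mul, Complex.conj_I]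
        push_cast
        rw [Complex.cos, Complex.sin]
        ring

/-- The fibre operator without its potential, `-∂² - 2iξ₁∂ + |ξ|²`. -/
noncomputable def freeFibre (ξ : EuclideanSpace ℝ (Fin d)) : circleH2 →ₗ[ℂ] L2Circle :=
  -circleDeriv2 - (2 * Complex.I * (ξ 0 : ℂ)) • circleDeriv
    + ((‖ξ‖ ^ 2 : ℝ) : ℂ) • circleH2.subtype

theorem circleCoeff_freeFibre (ξ : EuclideanSpace ℝ (Fin d)) (u : circleH2) (k : ℤ) :
    circleCoeff (freeFibre ξ u) k
      = (fibreSymbol (ξ 0) (transverseNorm ξ) k : ℂ) * circleCoeff u k := by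
  have h1 : circleCoeff (circleDeriv u) = coeffDeriv 1 (circleCoeff u) :=
    liftAlong_spec _ circleCoeff_injective _ _ u
  have h2 : circleCoeff (circleDeriv2 u) = coeffDeriv 2 (circleCoeff u) :=
    liftAlong_spec _ circleCoeff_injective _ _ u
  simp only [freeFibre, LinearMap.add_apply, LinearMap.sub_apply, LinearMap.neg_apply,
    LinearMap.smul_apply, map_add, map_sub, map_neg, map_smul, h1, h2, Pi.add_apply, Pi.sub_apply, Pi.neg_apply,
    Pi.smul_apply, smul_eq_mul, Submodule.subtype_apply]
  simp only [coeffDeriv, LinearMap.coe_mk, AddHom.coe_mk, fibreSymbol,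
    norm_sq_eq_add_transverseNorm_sq]
  push_cast
  linear_combination (-(k : ℂ) ^ 2 - 2 * (k : ℂ) * ξ 0) * circleCoeff u k * Complex.I_sq

/-- The key estimate: the quadratic form of the fibre operator is real and at least one tenth of the
form of its diagonal part. -/
theorem freeFibre_sub_potential_form (hd : d = 2 ∨ d = 3) (ξ : EuclideanSpace ℝ (Fin d))
    (u : circleH2) :
    ∃ q : ℝ, inner ℂ (u : L2Circle)
        (freeFibre ξ u - mulL2 _ _ (fibrePotential_memLp ξ) (u : L2Circle)) = (q : ℂ) ∧
      Summable (fun k => fibreSymbol (ξ 0) (transverseNorm ξ) k * ‖circleCoeff u k‖ ^ 2) ∧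
      1 / 10 * ∑' k, fibreSymbol (ξ 0) (transverseNorm ξ) k * ‖circleCoeff u k‖ ^ 2 ≤ q := by
  obtain ⟨w, hw, hV⟩ := exists_fibrePotential_eq hd ξ
  set a := circleCoeff (u : L2Circle) with ha
  set r := transverseNorm ξ with hr
  set D : L2Circle := freeFibre ξ u with hD
  set W : L2Circle := mulL2 _ _ (fibrePotential_memLp ξ) (u : L2Circle) with hW
  have hDsum : HasSum (fun k => fibreSymbol (ξ 0) r k * ‖a k‖ ^ 2)
      (∑' k, fibreSymbol (ξ 0) r k * ‖a k‖ ^ 2) := by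
    have h := (hasSum_conj_circleCoeff_mul (u : L2Circle) D).summable
    refine (Complex.summable_ofReal.mp (h.congr fun k => ?_)).hasSum
    rw [hD, circleCoeff_freeFibre, mul_left_comm, ← Complex.normSq_eq_conj_mul_self,
      Complex.normSq_eq_norm_sq]
    push_cast
    rfl
  have hDin : inner ℂ (u : L2Circle) D = ((∑' k, fibreSymbol (ξ 0) r k * ‖a k‖ ^ 2 : ℝ) : ℂ) := by
    have h := hasSum_conj_circleCoeff_mul (u : L2Circle) D
    refine h.unique ((Complex.hasSum_ofReal.mpr hDsum).congr_fun fun k => ?_)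
    rw [hD, circleCoeff_freeFibre, mul_left_comm, ← Complex.normSq_eq_conj_mul_self,
      Complex.normSq_eq_norm_sq]
    push_cast
    rfl
  have hsq : Summable fun k => ‖a k‖ ^ 2 := (hasSum_sq_circleCoeff (u : L2Circle)).summable
  have hsq' : Summable fun k : ℤ => ‖a (k + 1)‖ ^ 2 :=
    (Equiv.addRight (1 : ℤ)).summable_iff.mpr hsq
  have hpair : Summable fun k => ‖a k‖ * ‖a (k + 1)‖ := by
    refine (hsq.add hsq').of_nonneg_of_le (fun k => by positivity) fun k => ?_
    nlinarith [sq_nonneg (‖a k‖ - ‖a (k + 1)‖), sq_nonneg (‖a k‖), sq_nonneg (‖a (k + 1)‖)]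
  -- `z k` is the interaction of the neighbouring modes `k` and `k + 1`
  set z : ℤ → ℂ := fun k => starRingEnd ℂ (a (k + 1)) * (w * a k) with hz
  have hznorm : ∀ k, ‖z k‖ = ‖w‖ * (‖a k‖ * ‖a (k + 1)‖) := fun k => by
    simp only [hz, norm_mul, RCLike.norm_conj]; ring
  have hzs : Summable z := by
    refine Summable.of_norm ?_
    simp only [hznorm]
    exact hpair.mul_left _
  have hWin : inner ℂ (u : L2Circle) W = ((2 * (∑' k, z k).re : ℝ) : ℂ) := by
    have h := hasSum_conj_circleCoeff_mul (u : L2Circle) W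
    have h1 : HasSum (fun k => z (k - 1)) (∑' k, z k) :=
      ((Equiv.subRight (1 : ℤ)).hasSum_iff (f := z)).mpr hzs.hasSum
    have h2 : HasSum (fun k => starRingEnd ℂ (z k)) (starRingEnd ℂ (∑' k, z k)) :=
      Complex.hasSum_conj'.mpr hzs.hasSum
    have h3 : ∀ k, starRingEnd ℂ (circleCoeff (u : L2Circle) k) * circleCoeff W k
        = z (k - 1) + starRingEnd ℂ (z k) := fun k => by
      rw [hW, circleCoeff_mulL2_of_eq _ hV]
      simp only [hz, map_mul, Complex.conj_conj, sub_add_cancel, ha]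
      ring
    rw [h.unique ((h1.add h2).congr_fun h3), Complex.add_conj]
  refine ⟨∑' k, fibreSymbol (ξ 0) r k * ‖a k‖ ^ 2 - 2 * (∑' k, z k).re, ?_, hDsum.summable, ?_⟩
  · rw [inner_sub_right, hDin, hWin]
    push_cast
    ring
  · have h1 : 2 * (∑' k, z k).re ≤ r * ∑' k, ‖a k‖ * ‖a (k + 1)‖ := by
      calc 2 * (∑' k, z k).re ≤ 2 * ‖∑' k, z k‖ := by gcongr; exact Complex.re_le_norm _
        _ ≤ 2 * ∑' k, ‖z k‖ := by gcongr; exact norm_tsum_le_tsum_norm hzs.norm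
        _ = r * ∑' k, ‖a k‖ * ‖a (k + 1)‖ := by
          simp only [hznorm, tsum_mul_left, ← hw]; ring
    have h2 := tsum_mul_shift_le (t := ξ 0) (r := r) (b := fun k => ‖a k‖) hDsum.summable hpair
    linarith

/-- `freeFibre_sub_potential_form` for a vector given in the domain of the `LinearPMap`. -/
theorem fibreOperator_form (hd : d = 2 ∨ d = 3) (ξ : EuclideanSpace ℝ (Fin d))
    (u : (fibreOperator ξ).domain) :
    ∃ q : ℝ, inner ℂ (u : L2Circle) (fibreOperator ξ u) = (q : ℂ) ∧
      Summable (fun k => fibreSymbol (ξ 0) (transverseNorm ξ) k * ‖circleCoeff u k‖ ^ 2) ∧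
      1 / 10 * ∑' k, fibreSymbol (ξ 0) (transverseNorm ξ) k * ‖circleCoeff u k‖ ^ 2 ≤ q :=
  freeFibre_sub_potential_form hd ξ u

theorem fibreOperator_form_nonneg (hd : d = 2 ∨ d = 3) (ξ : EuclideanSpace ℝ (Fin d))
    (u : (fibreOperator ξ).domain) : 0 ≤ inner ℂ (u : L2Circle) (fibreOperator ξ u) := by
  obtain ⟨q, hq, -, hle⟩ := fibreOperator_form hd ξ u
  rw [hq]
  have : 0 ≤ ∑' k, fibreSymbol (ξ 0) (transverseNorm ξ) k * ‖circleCoeff u k‖ ^ 2 :=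
    tsum_nonneg fun k => mul_nonneg (fibreSymbol_nonneg _ _ k) (sq_nonneg _)
  exact_mod_cast (by linarith : 0 ≤ q)

/-- Eigenvalue bounds by comparison with the diagonal part: if the diagonal is at least `δ` outside
a set of `n` modes, then the `n`-th eigenvalue is at least `δ / 10`. -/
theorem le_of_mem_eigenvalueCountSet (hd : d = 2 ∨ d = 3) {ξ : EuclideanSpace ℝ (Fin d)} {n : ℕ}
    {μ : ℝ} (hμ : μ ∈ eigenvalueCountSet (fibreOperator ξ) n) {F : Finset ℤ} (hF : F.card ≤ n)
    {δ : ℝ} (hδ : ∀ k ∉ F, δ ≤ fibreSymbol (ξ 0) (transverseNorm ξ) k) : δ / 10 ≤ μ := by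
  obtain ⟨u, hu0, huF, hu⟩ := exists_form_le_of_mem_eigenvalueCountSet
    (fibreOperator_form_nonneg hd ξ) hμ (ι := F) (by simpa using hF)
    (LinearMap.funLeft ℂ ℂ (Subtype.val : F → ℤ) ∘ₗ circleCoeff)
  have hvan : ∀ k ∈ F, circleCoeff (u : L2Circle) k = 0 := fun k hk => congrFun huF ⟨k, hk⟩
  obtain ⟨q, hq, hs, hle⟩ := fibreOperator_form hd ξ u
  rw [hq, Complex.ofReal_re] at hu
  have h1 : δ * ‖(u : L2Circle)‖ ^ 2
      ≤ ∑' k, fibreSymbol (ξ 0) (transverseNorm ξ) k * ‖circleCoeff u k‖ ^ 2 := by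
    refine hasSum_le (fun k => ?_) ((hasSum_sq_circleCoeff (u : L2Circle)).mul_left δ) hs.hasSum
    by_cases hk : k ∈ F
    · simp [hvan k hk]
    · gcongr
      exact hδ k hk
  have h2 : 0 < ‖(u : L2Circle)‖ ^ 2 := by
    have := norm_pos_iff.mpr hu0
    positivity
  have h3 : δ / 10 * ‖(u : L2Circle)‖ ^ 2 ≤ μ * ‖(u : L2Circle)‖ ^ 2 := by linarith
  exact le_of_mul_le_mul_right h3 h2

theorem exists_finset_le_fibreSymbol (t r B : ℝ) :
    ∃ F : Finset ℤ, ∀ k ∉ F, B ≤ fibreSymbol t r k := by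
  obtain ⟨N, hN⟩ := exists_nat_ge (|B| + 1 + |t|)
  refine ⟨Finset.Icc (-N) N, fun k hk => ?_⟩
  have hk' : (N : ℝ) ≤ |(k : ℝ)| := by
    rw [Finset.mem_Icc, ← abs_le, not_le] at hk
    exact_mod_cast hk.le
  have h1 : |B| + 1 ≤ |(k : ℝ) + t| := by
    have := abs_sub_abs_le_abs_sub (k : ℝ) (-t)
    rw [abs_neg, sub_neg_eq_add] at this
    linarith
  unfold fibreSymbol
  have h2 := sq_abs ((k : ℝ) + t)
  nlinarith [le_abs_self B, abs_nonneg B, sq_nonneg r]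

theorem exists_not_mem_eigenvalueCountSet (hd : d = 2 ∨ d = 3) (ξ : EuclideanSpace ℝ (Fin d))
    (M : ℝ) : ∃ n, M ∉ eigenvalueCountSet (fibreOperator ξ) n := by
  obtain ⟨F, hF⟩ := exists_finset_le_fibreSymbol (ξ 0) (transverseNorm ξ) (10 * (M + 1))
  refine ⟨F.card, fun hM => ?_⟩
  have := le_of_mem_eigenvalueCountSet hd hM le_rfl hF
  linarith

theorem starNorm_sq_le_fibreSymbol (ξ : EuclideanSpace ℝ (Fin d)) (k : ℤ) :
    starNorm ξ ^ 2 ≤ fibreSymbol (ξ 0) (transverseNorm ξ) k := by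
  have hs : 0 ≤ ∑ j ∈ Finset.univ.erase (0 : Fin d), ξ j ^ 2 :=
    Finset.sum_nonneg fun j _ => sq_nonneg _
  rw [starNorm, Real.sq_sqrt (by positivity), fibreSymbol, transverseNorm, Real.sq_sqrt hs]
  gcongr ?_ + _
  rw [← sq_abs ((k : ℝ) + ξ 0)]
  have h0 : 0 ≤ ⨅ n : ℤ, |ξ 0 - n| := Real.iInf_nonneg fun n => abs_nonneg _
  have h1 : ⨅ n : ℤ, |ξ 0 - n| ≤ |ξ 0 - ((-k : ℤ) : ℝ)| :=
    ciInf_le ⟨0, by rintro _ ⟨n, rfl⟩; exact abs_nonneg _⟩ (-k)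
  rw [show ξ 0 - ((-k : ℤ) : ℝ) = k + ξ 0 by push_cast; ring] at h1
  gcongr

/-- All modes but one nearest to `-t` have distance at least `1 / 2` from `-t`. -/
theorem quarter_le_fibreSymbol {t r : ℝ} {k : ℤ} (hk : k ≠ round (-t)) :
    1 / 4 ≤ fibreSymbol t r k := by
  have h1 : (1 : ℝ) ≤ |((k - round (-t) : ℤ) : ℝ)| := by
    have := Int.one_le_abs (sub_ne_zero.mpr hk)
    exact_mod_cast this
  have h2 := abs_round_neg_add_le t
  have h3 : 1 / 2 ≤ |(k : ℝ) + t| := by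
    have := abs_sub ((k : ℝ) + t) ((round (-t) : ℤ) + t)
    rw [show (k : ℝ) + t - ((round (-t) : ℤ) + t) = ((k - round (-t) : ℤ) : ℝ) by
      push_cast; ring] at this
    linarith
  unfold fibreSymbol
  have h4 := sq_abs ((k : ℝ) + t)
  nlinarith [sq_nonneg r]

/-- For large `c` the diagonal operator `(-∂² - 2iξ₁∂ + |ξ|² + c)⁻¹` is a compact approximate
inverse of `A_ξ + c`. -/
theorem exists_fibre_parametrix (hd : d = 2 ∨ d = 3) (ξ : EuclideanSpace ℝ (Fin d)) :
    ∃ (c : ℝ) (G K : L2Circle →L[ℂ] L2Circle), 0 < c ∧ IsCompactOperator G ∧ ‖K‖ < 1 ∧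
      ∀ f, ∃ u : (fibreOperator ξ).domain, (u : L2Circle) = G f ∧
        fibreOperator ξ u + (c : ℂ) • (u : L2Circle) = f + K f := by
  obtain ⟨w, hw, hV⟩ := exists_fibrePotential_eq hd ξ
  set r := transverseNorm ξ with hr
  set s := fibreSymbol (ξ 0) r with hs
  have hr0 : 0 ≤ r := transverseNorm_nonneg ξ
  have hs0 : ∀ k, 0 ≤ s k := fibreSymbol_nonneg _ _
  have hVr : ∀ x, ‖(fibrePotential ξ x : ℂ)‖ ≤ r := fun x => by
    rw [hV, ← hw]
    refine (norm_add_le _ _).trans ?_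
    have h1 : ‖fourier 1 x‖ = 1 := Circle.norm_coe _
    have h2 : ‖fourier (-1) x‖ = 1 := Circle.norm_coe _
    rw [norm_mul, norm_mul, RCLike.norm_conj, h1, h2]
    linarith
  -- the potential is bounded by `r`, and the diagonal resolvent by `1 / c`
  set c := r + 1 with hc
  have hc0 : 0 < c := by positivity
  have hne : ∀ k, ((s k + c : ℝ) : ℂ) ≠ 0 := fun k => by
    have := hs0 k
    exact_mod_cast (by positivity : s k + c ≠ 0)
  obtain ⟨G, hGn, hG⟩ := exists_fourierMultiplier (m := fun k => ((s k + c : ℝ) : ℂ)⁻¹)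
    (C := c⁻¹) (by positivity) fun k => by
      have := hs0 k
      rw [norm_inv, Complex.norm_real, Real.norm_eq_abs, abs_of_pos (by positivity)]
      gcongr
      linarith
  set K : L2Circle →L[ℂ] L2Circle := -(mulL2CLM (fibrePotential_memLp ξ) hVr ∘L G) with hK
  refine ⟨c, G, K, hc0, ?_, ?_, fun f => ?_⟩
  · refine isCompactOperator_of_fourierMultiplier hG fun ε hε => ?_
    obtain ⟨F, hF⟩ := exists_finset_le_fibreSymbol (ξ 0) r (1 / ε)
    refine ⟨F, fun k hk => ?_⟩
    have h1 := hF k hk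
    have := hs0 k
    rw [norm_inv, Complex.norm_real, Real.norm_eq_abs, abs_of_pos (by positivity)]
    rw [inv_le_comm₀ (by positivity) hε, ← one_div]
    exact h1.trans (le_add_of_nonneg_right hc0.le)
  · rw [hK, norm_neg]
    calc _ ≤ r * c⁻¹ := (ContinuousLinearMap.opNorm_comp_le _ _).trans
          (mul_le_mul (LinearMap.mkContinuous_norm_le _ hr0 _) hGn (norm_nonneg _) hr0)
      _ < 1 := by rw [← div_eq_mul_inv, div_lt_one hc0]; linarith
  · have hbound : ∀ k : ℤ, (k : ℝ) ^ 2 ≤ 2 * (1 + (ξ 0) ^ 2) * (s k + c) := by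
      intro k
      simp only [hs, fibreSymbol]
      nlinarith [sq_nonneg ((k : ℝ) + 2 * ξ 0), sq_nonneg (ξ 0), sq_nonneg r,
        mul_nonneg (sq_nonneg (ξ 0)) (add_nonneg (add_nonneg (sq_nonneg ((k : ℝ) + ξ 0))
          (sq_nonneg r)) hr0)]
    have hdom : G f ∈ circleH2 := by
      constructor
      · refine exists_circleCoeff_eq (u := f) (C := 2 * (1 + (ξ 0) ^ 2)) fun k => ?_
        have := hs0 k
        have hk : |(k : ℝ)| ≤ (k : ℝ) ^ 2 := by
          rw [← sq_abs]
          rcases eq_or_ne k 0 with rfl | hk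
          · simp
          · have : (1 : ℝ) ≤ |(k : ℝ)| := by exact_mod_cast Int.one_le_abs hk
            nlinarith
        simp only [coeffDeriv, LinearMap.comp_apply, LinearMap.coe_mk, AddHom.coe_mk, hG, pow_one,
          norm_mul, norm_inv, Complex.norm_I, one_mul, Complex.norm_real, Real.norm_eq_abs,
          abs_of_pos (by positivity : 0 < s k + c), Complex.norm_intCast]
        rw [← mul_assoc]
        refine mul_le_mul_of_nonneg_right ?_ (norm_nonneg _)
        rw [← div_eq_mul_inv, div_le_iff₀ (by positivity)]
        exact hk.trans (hbound k)
      · refine exists_circleCoeff_eq (u := f) (C := 2 * (1 + (ξ 0) ^ 2)) fun k => ?_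
        have := hs0 k
        simp only [coeffDeriv, LinearMap.comp_apply, LinearMap.coe_mk, AddHom.coe_mk, hG, norm_pow,
          norm_mul, norm_inv, Complex.norm_I, one_mul, Complex.norm_real, Real.norm_eq_abs,
          abs_of_pos (by positivity : 0 < s k + c), Complex.norm_intCast, sq_abs]
        rw [← mul_assoc]
        refine mul_le_mul_of_nonneg_right ?_ (norm_nonneg _)
        rw [← div_eq_mul_inv, div_le_iff₀ (by positivity)]
        exact hbound k
    refine ⟨⟨G f, hdom⟩, rfl, ?_⟩
    have hA : fibreOperator ξ ⟨G f, hdom⟩ = freeFibre ξ ⟨G f, hdom⟩ + K f := sub_eq_add_neg _ _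
    rw [hA, add_right_comm]
    congr 1
    apply circleCoeff_injective
    funext k
    rw [map_add, map_smul, Pi.add_apply, Pi.smul_apply, circleCoeff_freeFibre, smul_eq_mul, hG]
    have := hne k
    change (s k : ℂ) * _ + _ = _
    push_cast at this ⊢
    field_simp

theorem isLeast_blochEigenvalue (hd : d = 2 ∨ d = 3) (ξ : EuclideanSpace ℝ (Fin d)) (n : ℕ) :
    IsLeast (eigenvalueCountSet (fibreOperator ξ) n) (blochEigenvalue n ξ) := by
  obtain ⟨c, G, K, hc, hGk, hK, hG⟩ := exists_fibre_parametrix hd ξ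
  obtain ⟨S, hR, -, hTR, -⟩ := exists_positive_resolvent (fibreOperator_form_nonneg hd ξ) hc hK hG
  exact isLeast_nthEigenvalue (fibreOperator_form_nonneg hd ξ)
    (eigenvalueCountSet_nonempty not_finiteDimensional_L2Circle hR (hGk.comp_clm S) hTR n)
    (exists_not_mem_eigenvalueCountSet hd ξ)

end FibreOperator

/-! ### The quadratic form of `A` on Schwartz functions -/

section SchwartzForm

open scoped ComplexOrder

variable {E : Type*} [NormedAddCommGroup E] [InnerProductSpace ℝ E] [FiniteDimensional ℝ E]
  [MeasurableSpace E] [BorelSpace E]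

theorem integrable_conj_mul (φ ψ : 𝓢(E, ℂ)) :
    Integrable (fun x => starRingEnd ℂ (φ x) * ψ x) := by
  have h := L2.integrable_inner (𝕜 := ℂ) (φ.toLp 2 volume) (ψ.toLp 2 volume)
  refine h.congr ?_
  filter_upwards [φ.coeFn_toLp 2 volume, ψ.coeFn_toLp 2 volume] with x h1 h2
  rw [h1, h2, RCLike.inner_apply, mul_comm]

theorem integrable_bdd_mul_conj_mul {b : E → ℝ} (hb : Continuous b) (hb1 : ∀ x, |b x| ≤ 1)
    (φ ψ : 𝓢(E, ℂ)) : Integrable (fun x => (b x : ℂ) * (starRingEnd ℂ (φ x) * ψ x)) := by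
  refine (integrable_conj_mul φ ψ).bdd_mul (c := 1)
    (Complex.continuous_ofReal.comp hb).aestronglyMeasurable
    (Filter.Eventually.of_forall fun x => ?_)
  simpa using hb1 x

theorem lineDerivOp_comm (v w : E) (φ : 𝓢(E, ℂ)) :
    (∂_{v} (∂_{w} φ) : 𝓢(E, ℂ)) = ∂_{w} (∂_{v} φ) := by
  have h1 : ∀ (v : E) (χ : 𝓢(E, ℂ)), (∂_{v} χ : 𝓢(E, ℂ)) = (2 * Real.pi * Complex.I) •
      SchwartzMap.fourierMultiplierCLM ℂ (fun x => ((inner ℝ x v : ℝ) : ℂ)) χ := fun v χ => by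
    rw [SchwartzMap.lineDeriv_eq_fourierMultiplierCLM,
      ← SchwartzMap.fourierMultiplierCLM_ofReal ℂ (by fun_prop)]
    rfl
  have h : ∀ v w : E, (∂_{v} (∂_{w} φ) : 𝓢(E, ℂ)) = (2 * Real.pi * Complex.I) •
      (2 * Real.pi * Complex.I) • SchwartzMap.fourierMultiplierCLM ℂ
        (fun x => ((inner ℝ x v : ℝ) : ℂ) * ((inner ℝ x w : ℝ) : ℂ)) φ := by
    intro v w
    rw [h1 v, h1 w, map_smul,
      SchwartzMap.fourierMultiplierCLM_fourierMultiplierCLM_apply (by fun_prop) (by fun_prop)]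
    rfl
  rw [h v w, h w v]
  simp only [mul_comm]

/-- Integration by parts with a bounded differentiable weight `b`. -/
theorem integral_bdd_mul_conj_mul_lineDeriv {b b' : E → ℝ} (hb : Continuous b)
    (hb1 : ∀ x, |b x| ≤ 1) (hb' : Continuous b') (hb1' : ∀ x, |b' x| ≤ 1) {v : E}
    (hbb' : ∀ x, HasLineDerivAt ℝ b (b' x) x v) (φ ψ : 𝓢(E, ℂ)) :
    ∫ x, (b x : ℂ) * (starRingEnd ℂ (φ x) * (∂_{v} ψ : 𝓢(E, ℂ)) x)
      = - ∫ x, ((b' x : ℂ) * (starRingEnd ℂ (φ x) * ψ x)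
        + (b x : ℂ) * (starRingEnd ℂ ((∂_{v} φ : 𝓢(E, ℂ)) x) * ψ x)) := by
  have hder : ∀ (χ : 𝓢(E, ℂ)) x, HasLineDerivAt ℝ χ ((∂_{v} χ : 𝓢(E, ℂ)) x) x v := fun χ x =>
    (χ.hasFDerivAt x).hasLineDerivAt v
  have h := integral_bilinear_hasLineDerivAt_right_eq_neg_left_of_integrable
    (μ := (volume : Measure E)) (B := ContinuousLinearMap.mul ℝ ℂ) (v := v)
    (f := fun x => (b x : ℂ) * starRingEnd ℂ (φ x))
    (f' := fun x => (b' x : ℂ) * starRingEnd ℂ (φ x)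
      + (b x : ℂ) * starRingEnd ℂ ((∂_{v} φ : 𝓢(E, ℂ)) x))
    (g := ψ) (g' := (∂_{v} ψ : 𝓢(E, ℂ)))
    (((integrable_bdd_mul_conj_mul hb' hb1' φ ψ).add
      (integrable_bdd_mul_conj_mul hb hb1 (∂_{v} φ) ψ)).congr
        (Filter.Eventually.of_forall fun x => by simp [mul_assoc]))
    ((integrable_bdd_mul_conj_mul hb hb1 φ (∂_{v} ψ)).congr
        (Filter.Eventually.of_forall fun x => by simp [mul_assoc]))
    ((integrable_bdd_mul_conj_mul hb hb1 φ ψ).congr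
        (Filter.Eventually.of_forall fun x => by simp [mul_assoc]))
    (fun x _ => by
      have h := (HasDerivAt.ofReal_comp (hbb' x)).mul (HasDerivAt.star (hder φ x))
      simp only [zero_smul, add_zero] at h
      exact h)
    (fun x _ => hder ψ x)
  simpa [add_mul, mul_assoc] using h

theorem integral_conj_mul_lineDeriv_lineDeriv (v : E) (ψ : 𝓢(E, ℂ)) :
    ∫ x, starRingEnd ℂ (ψ x) * (∂_{v} (∂_{v} ψ) : 𝓢(E, ℂ)) x
      = - ∫ x, ((‖(∂_{v} ψ : 𝓢(E, ℂ)) x‖ ^ 2 : ℝ) : ℂ) := by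
  have h := integral_bdd_mul_conj_mul_lineDeriv (v := v) (b := fun _ => 1) (b' := fun _ => 0)
    continuous_const (by simp) continuous_const (by simp)
    (fun x => hasDerivAt_const (0 : ℝ) (1 : ℝ)) ψ (∂_{v} ψ)
  simp only [Complex.ofReal_one, one_mul, Complex.ofReal_zero, zero_mul, zero_add] at h
  rw [h]
  congr 2
  funext x
  rw [← Complex.normSq_eq_conj_mul_self, Complex.normSq_eq_norm_sq]

/-- If the coefficient `b'` is the derivative in the direction `v` of a function `b` that is
constant in the direction `w`, then two integrations by parts turn the first-order term `i b' ∂_w`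
into an integral of an antisymmetric expression in the first derivatives. -/
theorem integral_coeff_conj_mul_lineDeriv {b b' : E → ℝ} (hb : Continuous b) (hb1 : ∀ x, |b x| ≤ 1)
    (hb' : Continuous b') (hb1' : ∀ x, |b' x| ≤ 1) {v w : E}
    (hbv : ∀ x, HasLineDerivAt ℝ b (b' x) x v) (hbw : ∀ x, HasLineDerivAt ℝ b 0 x w)
    (ψ : 𝓢(E, ℂ)) :
    Complex.I * ∫ x, (b' x : ℂ) * (starRingEnd ℂ (ψ x) * (∂_{w} ψ : 𝓢(E, ℂ)) x)
      = ∫ x, ((2 * b x *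
        (starRingEnd ℂ ((∂_{v} ψ : 𝓢(E, ℂ)) x) * (∂_{w} ψ : 𝓢(E, ℂ)) x).im : ℝ) : ℂ) := by
  have h1 := integral_bdd_mul_conj_mul_lineDeriv hb hb1 hb' hb1' hbv ψ (∂_{w} ψ)
  have h2 := integral_bdd_mul_conj_mul_lineDeriv hb hb1 (b' := fun _ => 0) continuous_const
    (by simp) hbw ψ (∂_{v} ψ)
  rw [lineDerivOp_comm v w ψ, h2] at h1
  simp only [Complex.ofReal_zero, zero_mul, zero_add] at h1
  rw [integral_add (integrable_bdd_mul_conj_mul hb' hb1' _ _)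
    (integrable_bdd_mul_conj_mul hb hb1 _ _)] at h1
  have h3 : ∫ x, (b' x : ℂ) * (starRingEnd ℂ (ψ x) * (∂_{w} ψ : 𝓢(E, ℂ)) x)
      = ∫ x, ((b x : ℂ) * (starRingEnd ℂ ((∂_{w} ψ : 𝓢(E, ℂ)) x) * (∂_{v} ψ : 𝓢(E, ℂ)) x)
        - (b x : ℂ) * (starRingEnd ℂ ((∂_{v} ψ : 𝓢(E, ℂ)) x) * (∂_{w} ψ : 𝓢(E, ℂ)) x)) := by
    rw [integral_sub (integrable_bdd_mul_conj_mul hb hb1 _ _)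
      (integrable_bdd_mul_conj_mul hb hb1 _ _)]
    linear_combination h1
  rw [h3, ← integral_const_mul]
  congr 1
  funext x
  set p := (∂_{v} ψ : 𝓢(E, ℂ)) x
  set q := (∂_{w} ψ : 𝓢(E, ℂ)) x
  apply Complex.ext <;> simp <;> ring

/-- The antiderivative of `helixCoeff j`, chosen such that for `d = 2, 3` the sum over `j < d` of
the squares is at most `1`. Only the indices `j < 3` matter. -/
noncomputable def helixPrimitive : ℕ → ℝ → ℝ
  | 1 => Real.sin
  | 2 => fun x => -Real.cos x
  | _ => fun _ => 0

theorem hasDerivAt_helixPrimitive (j : ℕ) (x : ℝ) :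
    HasDerivAt (helixPrimitive j) (helixCoeff j x) x := by
  match j with
  | 0 => exact hasDerivAt_const _ _
  | 1 => exact Real.hasDerivAt_sin x
  | 2 =>
    have h := (Real.hasDerivAt_cos x).neg
    rw [neg_neg] at h
    exact h
  | _ + 3 => exact hasDerivAt_const _ _

theorem helixPrimitive_abs_le (j : ℕ) (x : ℝ) : |helixPrimitive j x| ≤ 1 := by
  match j with
  | 0 => simp [helixPrimitive]
  | 1 => exact Real.abs_sin_le_one x
  | 2 => simpa [helixPrimitive] using Real.abs_cos_le_one x
  | _ + 3 => simp [helixPrimitive]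

variable {d : ℕ} [NeZero d]

/-- With `q = ∑ j, helixPrimitive j θ * p j`, the sum is at least `|p 0|² + |q|² + 2 Im (conj (p 0)
q)`, because the coefficients have square sum at most `1`; this is `|p 0 - i q|²`. -/
theorem helix_pointwise_nonneg (hd : d = 2 ∨ d = 3) (p : Fin d → ℂ) (θ : ℝ) :
    0 ≤ ∑ j, ‖p j‖ ^ 2 + ∑ j : Fin d, 2 * helixPrimitive j θ * (starRingEnd ℂ (p 0) * p j).im := by
  simp only [← Complex.normSq_eq_norm_sq, Complex.normSq_apply, Complex.mul_im, Complex.conj_re,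
    Complex.conj_im]
  rcases hd with rfl | rfl
  · simp only [Fin.sum_univ_two, helixPrimitive, Fin.val_zero, Fin.val_one]
    have h := Real.sin_sq_le_one θ
    nlinarith [sq_nonneg ((p 0).re + Real.sin θ * (p 1).im),
      sq_nonneg ((p 0).im - Real.sin θ * (p 1).re),
      mul_nonneg (sub_nonneg.mpr h) (sq_nonneg (p 1).re),
      mul_nonneg (sub_nonneg.mpr h) (sq_nonneg (p 1).im)]
  · simp only [Fin.sum_univ_three, helixPrimitive, Fin.val_zero, Fin.val_one, Fin.val_two]
    have h := Real.sin_sq_add_cos_sq θ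
    have key : (p 0).re * (p 0).re + (p 0).im * (p 0).im
        + ((p 1).re * (p 1).re + (p 1).im * (p 1).im)
        + ((p 2).re * (p 2).re + (p 2).im * (p 2).im)
        + 2 * Real.sin θ * ((p 0).re * (p 1).im + -(p 0).im * (p 1).re)
        + 2 * -Real.cos θ * ((p 0).re * (p 2).im + -(p 0).im * (p 2).re)
        = ((p 0).re + (Real.sin θ * (p 1).im - Real.cos θ * (p 2).im)) ^ 2
        + ((p 0).im - (Real.sin θ * (p 1).re - Real.cos θ * (p 2).re)) ^ 2
        + (Real.cos θ * (p 1).re + Real.sin θ * (p 2).re) ^ 2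
        + (Real.cos θ * (p 1).im + Real.sin θ * (p 2).im) ^ 2 := by
      linear_combination (-(p 1).re ^ 2 - (p 1).im ^ 2 - (p 2).re ^ 2 - (p 2).im ^ 2) * h
    have := sq_nonneg ((p 0).re + (Real.sin θ * (p 1).im - Real.cos θ * (p 2).im))
    have := sq_nonneg ((p 0).im - (Real.sin θ * (p 1).re - Real.cos θ * (p 2).re))
    have := sq_nonneg (Real.cos θ * (p 1).re + Real.sin θ * (p 2).re)
    have := sq_nonneg (Real.cos θ * (p 1).im + Real.sin θ * (p 2).im)
    linarith

theorem inner_toLp_mulL2 {b : E → ℂ} (hb : MemLp b ∞ volume) (φ ψ : 𝓢(E, ℂ)) :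
    inner ℂ (φ.toLp 2 volume) (mulL2 volume b hb (ψ.toLp 2 volume))
      = ∫ x, b x * (starRingEnd ℂ (φ x) * ψ x) := by
  rw [L2.inner_def]
  refine integral_congr_ae ?_
  filter_upwards [φ.coeFn_toLp 2 volume, ψ.coeFn_toLp 2 volume, coeFn_mulL2 hb (ψ.toLp 2 volume)]
    with x h1 h2 h3
  rw [h3, h1, h2, RCLike.inner_apply]
  ring

/-- The quadratic form of `A` is nonnegative on Schwartz functions: after integration by parts it is
the integral of the expression in `helix_pointwise_nonneg`. -/
theorem schwartz_form_nonneg (hd : d = 2 ∨ d = 3) (ψ : 𝓢(EuclideanSpace ℝ (Fin d), ℂ)) :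
    0 ≤ inner ℂ (ψ.toLp 2 volume) (-((Δ ψ).toLp 2 volume) + Complex.I • ∑ j : Fin d,
      mulL2 volume _ (helixCoeff_memLp_space d (j : ℕ))
        ((∂_{EuclideanSpace.single j (1 : ℝ)} ψ : 𝓢(EuclideanSpace ℝ (Fin d), ℂ)).toLp
          2 volume)) := by
  set D : Fin d → 𝓢(EuclideanSpace ℝ (Fin d), ℂ) := fun j =>
    ∂_{EuclideanSpace.single j (1 : ℝ)} ψ with hD
  have hx0 : ∀ (j : Fin d) (x : EuclideanSpace ℝ (Fin d)),
      HasDerivAt (fun t : ℝ => (x + t • EuclideanSpace.single j (1 : ℝ)) 0)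
        (if j = 0 then 1 else 0) 0 := by
    intro j x
    have : (fun t : ℝ => (x + t • EuclideanSpace.single j (1 : ℝ)) 0)
        = fun t : ℝ => x 0 + t * (if j = 0 then 1 else 0) := by
      funext t
      simp [eq_comm]
    rw [this]
    simpa using ((hasDerivAt_id (0 : ℝ)).mul_const (if j = 0 then (1 : ℝ) else 0)).const_add (x 0)
  have hprim : ∀ (i j : Fin d) (x : EuclideanSpace ℝ (Fin d)),
      HasLineDerivAt ℝ (fun x : EuclideanSpace ℝ (Fin d) => helixPrimitive i (x 0))
        (helixCoeff i (x 0) * if j = 0 then 1 else 0) x (EuclideanSpace.single j (1 : ℝ)) := by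
    intro i j x
    have h := hasDerivAt_helixPrimitive i (x 0)
    refine HasDerivAt.comp (0 : ℝ) (h₂ := helixPrimitive i) ?_ (hx0 j x)
    simpa using h
  have hcont : ∀ j, Continuous fun x : EuclideanSpace ℝ (Fin d) => helixPrimitive j (x 0) :=
    fun j =>
    (continuous_iff_continuousAt.mpr fun x => (hasDerivAt_helixPrimitive j x).continuousAt).comp
      (by fun_prop)
  have hcont' : ∀ j, Continuous fun x : EuclideanSpace ℝ (Fin d) => helixCoeff j (x 0) := fun j =>
    (helixCoeff_continuous j).comp (by fun_prop)
  -- the term `j = 0` vanishes, since `helixCoeff 0 = 0`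
  have hfirst : ∀ j : Fin d, Complex.I * inner ℂ (ψ.toLp 2 volume)
      (mulL2 volume _ (helixCoeff_memLp_space d (j : ℕ)) ((D j).toLp 2 volume))
      = ∫ x, ((2 * helixPrimitive j (x 0) * (starRingEnd ℂ (D 0 x) * D j x).im : ℝ) : ℂ) := by
    intro j
    rw [inner_toLp_mulL2]
    rcases eq_or_ne j 0 with rfl | hj
    · simp [helixCoeff, helixPrimitive]
    · exact integral_coeff_conj_mul_lineDeriv (hcont j) (fun x => helixPrimitive_abs_le j _)
        (hcont' j) (fun x => helixCoeff_abs_le j _)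
        (fun x => by simpa using hprim j 0 x) (fun x => by simpa [hj] using hprim j j x) ψ
  have hsecond : inner ℂ (ψ.toLp 2 volume) ((Δ ψ).toLp 2 volume)
      = -∑ j, ∫ x, ((‖D j x‖ ^ 2 : ℝ) : ℂ) := by
    rw [SchwartzMap.inner_toL2_toL2_eq ψ (Δ ψ) volume,
      SchwartzMap.laplacian_eq_sum (EuclideanSpace.basisFun (Fin d) ℝ), ← Finset.sum_neg_distrib]
    simp only [_root_.sum_apply, Finset.mul_sum, RCLike.inner_apply', EuclideanSpace.basisFun_apply]
    rw [integral_finsetSum _ fun j _ => integrable_conj_mul _ _]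
    exact Finset.sum_congr rfl fun j _ => integral_conj_mul_lineDeriv_lineDeriv _ ψ
  have hint1 : ∀ j, Integrable fun x => ‖D j x‖ ^ 2 := fun j => by
    have h := (integrable_conj_mul (D j) (D j)).re
    refine h.congr (Filter.Eventually.of_forall fun x => ?_)
    change (starRingEnd ℂ (D j x) * D j x).re = _
    rw [← Complex.normSq_eq_conj_mul_self, Complex.normSq_eq_norm_sq, Complex.ofReal_re]
  have hint2 : ∀ j : Fin d, Integrable fun x : EuclideanSpace ℝ (Fin d) =>
      2 * helixPrimitive j (x 0) * (starRingEnd ℂ (D 0 x) * D j x).im := fun j => by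
    have h := (integrable_bdd_mul_conj_mul (hcont j) (fun x => helixPrimitive_abs_le j _)
      (D 0) (D j)).im.const_mul 2
    refine h.congr (Filter.Eventually.of_forall fun x => ?_)
    change 2 * ((helixPrimitive j (x 0) : ℂ) * (starRingEnd ℂ (D 0 x) * D j x)).im = _
    rw [Complex.im_ofReal_mul, ← mul_assoc]
  rw [inner_add_right, inner_neg_right, inner_smul_right, inner_sum, Finset.mul_sum, hsecond,
    neg_neg, Finset.sum_congr rfl fun j _ => hfirst j]
  simp only [integral_complex_ofReal]
  rw [← Complex.ofReal_sum, ← Complex.ofReal_sum, ← Complex.ofReal_add,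
    ← integral_finsetSum _ fun j _ => hint1 j, ← integral_finsetSum _ fun j _ => hint2 j,
    ← integral_add (integrable_finsetSum _ fun j _ => hint1 j)
      (integrable_finsetSum _ fun j _ => hint2 j)]
  exact_mod_cast integral_nonneg fun x => helix_pointwise_nonneg hd (fun j => D j x) (x 0)

end SchwartzForm

/-! ### The operator `A` on `H²(ℝ^d)` -/

section WholeSpaceOperator

open scoped ComplexOrder

variable {d : ℕ}

/-- A bounded Fourier multiplier on tempered distributions acts on `L²`, by Plancherel's theorem. -/
theorem exists_l2_fourierMultiplier {m : EuclideanSpace ℝ (Fin d) → ℂ}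
    (hm : m.HasTemperateGrowth) {C : ℝ} (hC : 0 ≤ C) (hmC : ∀ x, ‖m x‖ ≤ C) :
    ∃ M : L2Space d →L[ℂ] L2Space d, ‖M‖ ≤ C ∧
      ∀ f, toDistr d (M f) = TemperedDistribution.fourierMultiplierCLM ℂ m (toDistr d f) := by
  have hmem : MemLp m ∞ (volume : Measure (EuclideanSpace ℝ (Fin d))) :=
    memLp_top_of_bound hm.1.continuous.aestronglyMeasurable C (Filter.Eventually.of_forall hmC)
  let 𝓕₂ := Lp.fourierTransformₗᵢ (EuclideanSpace ℝ (Fin d)) ℂ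
  refine ⟨(𝓕₂.symm.toContinuousLinearEquiv : L2Space d →L[ℂ] L2Space d) ∘L mulL2CLM hmem hmC ∘L
    (𝓕₂.toContinuousLinearEquiv : L2Space d →L[ℂ] L2Space d), ?_, fun f => ?_⟩
  · refine ContinuousLinearMap.opNorm_le_bound _ hC fun f => ?_
    change ‖𝓕₂.symm (mulL2 _ m hmem (𝓕₂ f))‖ ≤ _
    rw [LinearIsometryEquiv.norm_map, ← 𝓕₂.norm_map f]
    exact norm_mulL2_le hmem hmC _
  · change Lp.toTemperedDistribution (FourierTransformInv.fourierInv
      (mulL2 _ m hmem (FourierTransform.fourier f))) = _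
    rw [← Lp.fourierInv_toTemperedDistribution_eq, TemperedDistribution.fourierMultiplierCLM_apply]
    congr 1
    change Lp.toTemperedDistribution
      (hmem.toLp m • (FourierTransform.fourier f : L2Space d) : L2Space d) = _
    rw [Lp.toTemperedDistribution_smul_eq hm, ← Lp.fourier_toTemperedDistribution_eq]
    rfl

/-- The Bessel potential `(1 - (2π)⁻² Δ)⁻¹`, with symbol `(1 + ‖x‖²)⁻¹`, as a bounded operator of
`L²` onto `H²`. -/
theorem exists_l2_besselPotential (d : ℕ) :
    ∃ J : L2Space d →L[ℂ] L2Space d,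
      (∀ f, toDistr d (J f) = TemperedDistribution.besselPotential _ _ (-2) (toDistr d f)) ∧
      ∀ u ∈ sobolevH2 d, ∃ f, J f = u := by
  obtain ⟨J, -, hJ⟩ := exists_l2_fourierMultiplier (d := d)
    (m := fun x => (((1 + ‖x‖ ^ 2) ^ ((-2 : ℝ) / 2) : ℝ) : ℂ)) (by fun_prop) zero_le_one fun x => by
      rw [Complex.norm_real, Real.norm_eq_abs, abs_of_nonneg (by positivity)]
      exact Real.rpow_le_one_of_one_le_of_nonpos (by simp) (by norm_num)
  refine ⟨J, hJ, fun u hu => ?_⟩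
  obtain ⟨f, hf⟩ := hu
  refine ⟨f, toDistr_injective d ?_⟩
  rw [hJ]
  exact (TemperedDistribution.besselPotential_neg_apply_eq_iff 2 _ _).mpr hf

theorem bessel_mem_sobolevH2 {J : L2Space d →L[ℂ] L2Space d}
    (hJ : ∀ f, toDistr d (J f) = TemperedDistribution.besselPotential _ _ (-2) (toDistr d f))
    (f : L2Space d) : J f ∈ sobolevH2 d := by
  change TemperedDistribution.MemSobolev 2 2 (toDistr d (J f))
  rw [hJ, TemperedDistribution.memSobolev_besselPotential_iff]
  rw [neg_add_cancel, TemperedDistribution.memSobolev_zero_iff]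
  exact ⟨f, rfl⟩

theorem toDistr_partialH2 (u : sobolevH2 d) (j : Fin d) :
    toDistr d (partialH2 d j u) = ∂_{EuclideanSpace.single j (1 : ℝ)} (toDistr d u) :=
  liftAlong_spec (toDistr d) (toDistr_injective d) _ _ u

theorem toDistr_laplacianH2 (u : sobolevH2 d) :
    toDistr d (laplacianH2 d u) = Δ (toDistr d u) :=
  (liftAlong_spec (toDistr d) (toDistr_injective d) _ _ u).trans
    (TemperedDistribution.laplacianCLM_apply _)

theorem laplacianH2_bessel {J : L2Space d →L[ℂ] L2Space d}
    (hJ : ∀ f, toDistr d (J f) = TemperedDistribution.besselPotential _ _ (-2) (toDistr d f))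
    (f : L2Space d) :
    laplacianH2 d ⟨J f, bessel_mem_sobolevH2 hJ f⟩
      = ((2 * Real.pi) ^ 2 : ℂ) • (J f - f) := by
  apply toDistr_injective d
  rw [toDistr_laplacianH2, map_smul, map_sub]
  rw [hJ, TemperedDistribution.laplacian_eq_fourierMultiplierCLM,
    TemperedDistribution.besselPotential,
    TemperedDistribution.fourierMultiplierCLM_fourierMultiplierCLM_apply (by fun_prop)
      (by fun_prop)]
  -- on the Fourier side this is `‖x‖² (1 + ‖x‖²)⁻¹ = 1 - (1 + ‖x‖²)⁻¹`
  have hsymb : (fun x : EuclideanSpace ℝ (Fin d) => (((1 + ‖x‖ ^ 2) ^ ((-2 : ℝ) / 2) : ℝ) : ℂ)) *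
      (fun x => Complex.ofReal (‖x‖ ^ 2)) =
      (fun _ => (1 : ℂ)) - fun x => (((1 + ‖x‖ ^ 2) ^ ((-2 : ℝ) / 2) : ℝ) : ℂ) := by
    funext x
    have h2 : ((1 + ‖x‖ ^ 2) ^ ((-2 : ℝ) / 2) : ℝ) = (1 + ‖x‖ ^ 2)⁻¹ := by
      rw [show (-2 : ℝ) / 2 = -1 by norm_num, Real.rpow_neg_one]
    have h3 : (1 + ‖x‖ ^ 2)⁻¹ * ‖x‖ ^ 2 = 1 - (1 + ‖x‖ ^ 2)⁻¹ := by
      have : (1 + ‖x‖ ^ 2) ≠ 0 := by positivity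
      field_simp
      ring
    simp only [Pi.mul_apply, Pi.sub_apply, h2]
    exact_mod_cast h3
  have hsub : ∀ (b : EuclideanSpace ℝ (Fin d) → ℂ), b.HasTemperateGrowth → ∀ F,
      TemperedDistribution.fourierMultiplierCLM ℂ ((fun _ => (1 : ℂ)) - b) F
        = F - TemperedDistribution.fourierMultiplierCLM ℂ b F := fun b hb F => by
    simp only [TemperedDistribution.fourierMultiplierCLM_apply]
    rw [TemperedDistribution.smulLeftCLM_sub (by fun_prop) hb, _root_.sub_apply,
      TemperedDistribution.smulLeftCLM_const, one_smul, sub_eq_add_neg,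
      FourierTransform.fourierInv_add, FourierTransform.fourierInv_neg,
      FourierTransform.fourierInv_fourier_eq, ← sub_eq_add_neg]
  rw [hsymb, hsub _ (by fun_prop), ← neg_sub, smul_neg, ← neg_smul]
  simp only [← Complex.coe_smul, neg_neg]
  push_cast
  rfl

/-- `∂_j` composed with the Bessel potential is bounded by `π`, since `2π |x_j| ≤ π (1 + ‖x‖²)`. -/
theorem exists_partialH2_bessel {J : L2Space d →L[ℂ] L2Space d}
    (hJ : ∀ f, toDistr d (J f) = TemperedDistribution.besselPotential _ _ (-2) (toDistr d f))
    (j : Fin d) :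
    ∃ D : L2Space d →L[ℂ] L2Space d, ‖D‖ ≤ Real.pi ∧
      ∀ f, partialH2 d j ⟨J f, bessel_mem_sobolevH2 hJ f⟩ = D f := by
  obtain ⟨D, hD, hD'⟩ := exists_l2_fourierMultiplier (d := d)
    (m := fun x => (2 * Real.pi * Complex.I) *
      ((((1 + ‖x‖ ^ 2) ^ ((-2 : ℝ) / 2) : ℝ) : ℂ) *
        ((inner ℝ x (EuclideanSpace.single j (1 : ℝ)) : ℝ) : ℂ))) (by fun_prop)
    Real.pi_pos.le fun x => by
      have h1 : |inner ℝ x (EuclideanSpace.single j (1 : ℝ))| ≤ ‖x‖ := by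
        simpa using abs_real_inner_le_norm x (EuclideanSpace.single j (1 : ℝ))
      have h2 : ((1 + ‖x‖ ^ 2) ^ ((-2 : ℝ) / 2) : ℝ) = (1 + ‖x‖ ^ 2)⁻¹ := by
        rw [show (-2 : ℝ) / 2 = -1 by norm_num, Real.rpow_neg_one]
      rw [h2]
      simp only [norm_mul, Complex.norm_I, Complex.norm_real, Real.norm_eq_abs, mul_one,
        Complex.norm_ofNat, abs_of_pos Real.pi_pos]
      rw [abs_of_pos (by positivity : (0 : ℝ) < (1 + ‖x‖ ^ 2)⁻¹), mul_comm _ |_|,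
        ← div_eq_mul_inv, ← mul_div_assoc, div_le_iff₀ (by positivity)]
      nlinarith [sq_nonneg (‖x‖ - 1), Real.pi_pos, mul_le_mul_of_nonneg_left h1 Real.pi_pos.le,
        mul_nonneg Real.pi_pos.le (sq_nonneg (‖x‖ - 1))]
  refine ⟨D, hD, fun f => toDistr_injective d ?_⟩
  rw [toDistr_partialH2, hD', hJ, TemperedDistribution.lineDeriv_eq_fourierMultiplierCLM,
    TemperedDistribution.besselPotential,
    TemperedDistribution.fourierMultiplierCLM_fourierMultiplierCLM_apply (by fun_prop)
      (by fun_prop)]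
  change _ = TemperedDistribution.fourierMultiplierCLM ℂ ((2 * Real.pi * Complex.I : ℂ) • _) _
  rw [TemperedDistribution.fourierMultiplierCLM_smul (by fun_prop)]
  rfl

variable [NeZero d]

/-- The quadratic form of `A` is nonnegative on `H²`: with the Bessel potential `J` it becomes the
continuous form `f ↦ ⟨J f, A J f⟩` on `L²`, and `J` maps the dense set of Schwartz functions to
Schwartz functions. -/
theorem helixOperator_form_nonneg (hd : d = 2 ∨ d = 3) (u : (helixOperator d).domain) :
    0 ≤ inner ℂ (u : L2Space d) (helixOperator d u) := by
  obtain ⟨J, hJ, hJsurj⟩ := exists_l2_besselPotential d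
  choose D hDn hD using exists_partialH2_bessel hJ
  have hmulc : ∀ j : Fin d, ∀ x : EuclideanSpace ℝ (Fin d), ‖(helixCoeff j (x 0) : ℂ)‖ ≤ 1 :=
    fun j x => by simpa using helixCoeff_abs_le j (x 0)
  -- `L = A ∘ J` as a bounded operator on `L²`
  set L : L2Space d →L[ℂ] L2Space d := -(((2 * Real.pi) ^ 2 : ℂ) • (J - 1)) + Complex.I •
    ∑ j : Fin d, mulL2CLM (helixCoeff_memLp_space d (j : ℕ)) (hmulc j) ∘L D j with hL
  have hLJ : ∀ f, helixOperator d ⟨J f, bessel_mem_sobolevH2 hJ f⟩ = L f := by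
    intro f
    change (-laplacianH2 d + Complex.I • ∑ j : Fin d,
      mulL2 volume _ (helixCoeff_memLp_space d (j : ℕ)) ∘ₗ partialH2 d j)
        ⟨J f, bessel_mem_sobolevH2 hJ f⟩ = L f
    simp only [hL, LinearMap.add_apply, LinearMap.neg_apply, LinearMap.smul_apply,
      LinearMap.sum_apply, LinearMap.comp_apply, laplacianH2_bessel hJ, hD, _root_.add_apply,
      _root_.neg_apply, _root_.smul_apply, _root_.sub_apply, _root_.sum_apply,
      ContinuousLinearMap.comp_apply, one_apply_eq_self]
    rfl
  suffices h : ∀ f, 0 ≤ inner ℂ (J f) (L f) by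
    obtain ⟨f, hf⟩ := hJsurj u u.2
    have hu : u = ⟨J f, bessel_mem_sobolevH2 hJ f⟩ := Subtype.ext hf.symm
    rw [hu, hLJ]
    exact h f
  intro f
  refine DenseRange.induction_on (p := fun f => 0 ≤ inner ℂ (J f) (L f))
    (SchwartzMap.denseRange_toLpCLM (p := 2) ENNReal.ofNat_ne_top) f ?_ fun φ => ?_
  · exact isClosed_le continuous_const (J.continuous.inner L.continuous)
  · set ψ := SchwartzMap.fourierMultiplierCLM ℂ
      (fun x : EuclideanSpace ℝ (Fin d) => (((1 + ‖x‖ ^ 2) ^ ((-2 : ℝ) / 2) : ℝ) : ℂ)) φ with hψ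
    have hcoe : ∀ χ : 𝓢(EuclideanSpace ℝ (Fin d), ℂ), toDistr d (χ.toLp 2 volume) =
        SchwartzMap.toTemperedDistributionCLM _ _ volume χ := fun χ =>
      Lp.toTemperedDistribution_toLp_eq χ
    have hJφ : J (φ.toLp 2 volume) = ψ.toLp 2 volume := by
      apply toDistr_injective d
      rw [hJ, hcoe, hcoe, TemperedDistribution.besselPotential,
        TemperedDistribution.fourierMultiplierCLM_toTemperedDistributionCLM_eq (by fun_prop)]
    have hmem : ψ.toLp 2 volume ∈ sobolevH2 d := hJφ ▸ bessel_mem_sobolevH2 hJ _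
    have hlap : laplacianH2 d ⟨_, hmem⟩ = (Δ ψ).toLp 2 volume := by
      apply toDistr_injective d
      rw [toDistr_laplacianH2, hcoe, hcoe]
      exact TemperedDistribution.laplacian_toTemperedDistributionCLM_eq ψ
    have hpar : ∀ j, partialH2 d j ⟨_, hmem⟩ =
        (∂_{EuclideanSpace.single j (1 : ℝ)} ψ : 𝓢(EuclideanSpace ℝ (Fin d), ℂ)).toLp 2 volume := by
      intro j
      apply toDistr_injective d
      rw [toDistr_partialH2, hcoe, hcoe]
      exact TemperedDistribution.lineDerivOp_toTemperedDistributionCLM_eq ψ _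
    have h1 : L (φ.toLp 2 volume) = helixOperator d ⟨_, hmem⟩ := by
      rw [← hLJ]
      congr 2
    have h2 : helixOperator d ⟨_, hmem⟩ = -((Δ ψ).toLp 2 volume) + Complex.I • ∑ j : Fin d,
        mulL2 volume _ (helixCoeff_memLp_space d (j : ℕ))
          ((∂_{EuclideanSpace.single j (1 : ℝ)} ψ : 𝓢(EuclideanSpace ℝ (Fin d), ℂ)).toLp
            2 volume) := by
      change (-laplacianH2 d + Complex.I • ∑ j : Fin d,
        mulL2 volume _ (helixCoeff_memLp_space d (j : ℕ)) ∘ₗ partialH2 d j) ⟨_, hmem⟩ = _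
      simp only [LinearMap.add_apply, LinearMap.neg_apply, LinearMap.smul_apply,
        LinearMap.sum_apply, LinearMap.comp_apply, hlap, hpar]
    change 0 ≤ inner ℂ (J (φ.toLp 2 volume)) (L (φ.toLp 2 volume))
    rw [h1, h2, hJφ]
    exact schwartz_form_nonneg hd ψ

/-- For `c = (2π)²` the resolvent `(-Δ + c)⁻¹` is an approximate inverse of `A + c`: the first-order
term contributes an error of norm at most `d π / (2π)² < 1`. -/
theorem exists_helix_parametrix (hd : d = 2 ∨ d = 3) :
    ∃ (c : ℝ) (G K : L2Space d →L[ℂ] L2Space d), 0 < c ∧ ‖K‖ < 1 ∧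
      ∀ f, ∃ u : (helixOperator d).domain, (u : L2Space d) = G f ∧
        helixOperator d u + (c : ℂ) • (u : L2Space d) = f + K f := by
  obtain ⟨J, hJ, -⟩ := exists_l2_besselPotential d
  choose D hDn hD using exists_partialH2_bessel hJ
  have hmulc : ∀ j : Fin d, ∀ x : EuclideanSpace ℝ (Fin d), ‖(helixCoeff j (x 0) : ℂ)‖ ≤ 1 :=
    fun j x => by simpa using helixCoeff_abs_le j (x 0)
  set c : ℝ := (2 * Real.pi) ^ 2 with hc
  have hc0 : 0 < c := by positivity
  have hcne : (c : ℂ) ≠ 0 := by exact_mod_cast hc0.ne'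
  set B : L2Space d →L[ℂ] L2Space d := Complex.I •
    ∑ j : Fin d, mulL2CLM (helixCoeff_memLp_space d (j : ℕ)) (hmulc j) ∘L D j with hB
  have hBn : ‖B‖ ≤ d * Real.pi := by
    rw [hB, norm_smul, Complex.norm_I, one_mul]
    refine (norm_sum_le _ _).trans ?_
    refine (Finset.sum_le_card_nsmul _ _ Real.pi fun j _ => ?_).trans (by simp)
    refine (ContinuousLinearMap.opNorm_comp_le _ _).trans ?_
    calc _ ≤ 1 * Real.pi := mul_le_mul (LinearMap.mkContinuous_norm_le _ zero_le_one _) (hDn j)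
          (norm_nonneg _) zero_le_one
      _ = Real.pi := one_mul _
  refine ⟨c, (c : ℂ)⁻¹ • J, (c : ℂ)⁻¹ • B, hc0, ?_, fun f => ?_⟩
  · rw [norm_smul, norm_inv, Complex.norm_real, Real.norm_eq_abs, abs_of_pos hc0, ← div_eq_inv_mul,
      div_lt_one hc0]
    have hd3 : (d : ℝ) ≤ 3 := by rcases hd with rfl | rfl <;> norm_num
    nlinarith [Real.pi_gt_three, mul_le_mul_of_nonneg_right hd3 Real.pi_pos.le]
  · refine ⟨(c : ℂ)⁻¹ • ⟨J f, bessel_mem_sobolevH2 hJ f⟩, rfl, ?_⟩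
    have hA : helixOperator d ⟨J f, bessel_mem_sobolevH2 hJ f⟩ = (c : ℂ) • (f - J f) + B f := by
      change (-laplacianH2 d + Complex.I • ∑ j : Fin d, mulL2 volume _
        (helixCoeff_memLp_space d (j : ℕ)) ∘ₗ partialH2 d j) ⟨J f, bessel_mem_sobolevH2 hJ f⟩ = _
      simp only [hB, LinearMap.add_apply, LinearMap.neg_apply, LinearMap.smul_apply,
        LinearMap.sum_apply, LinearMap.comp_apply, laplacianH2_bessel hJ, hD,
        _root_.smul_apply, _root_.sum_apply, ContinuousLinearMap.comp_apply]
      rw [← smul_neg, neg_sub, hc]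
      push_cast
      rfl
    rw [LinearPMap.map_smul, hA, Submodule.coe_smul, smul_inv_smul₀ hcne, smul_add, smul_smul,
      inv_mul_cancel₀ hcne, one_smul, _root_.smul_apply]
    abel

end WholeSpaceOperator

theorem proposition2 (d : ℕ) [NeZero d] (hd : d = 2 ∨ d = 3) :
    (∀ ξ ∈ dualTorus d, ∀ n : ℕ,
      IsLeast (eigenvalueCountSet (fibreOperator ξ) n) (blochEigenvalue n ξ)) ∧
    (∃ θ₀ : ℝ, 0 < θ₀ ∧ ∃ C : ℝ, 0 < C ∧ ∀ ξ ∈ dualTorus d,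
      θ₀ * starNorm ξ ^ 2 ≤ blochEigenvalue 0 ξ ∧
      ∀ n : ℕ, 1 ≤ n → C ≤ blochEigenvalue n ξ) ∧
    pmapSpectrum (helixOperator d) ⊆ {z : ℂ | ∃ r : ℝ, 0 ≤ r ∧ z = (r : ℂ)} := by
  refine ⟨fun ξ _ n => isLeast_blochEigenvalue hd ξ n,
    ⟨1 / 10, by norm_num, 1 / 40, by norm_num, fun ξ _ => ⟨?_, fun n hn => ?_⟩⟩, ?_⟩
  · have := le_of_mem_eigenvalueCountSet hd (isLeast_blochEigenvalue hd ξ 0).1 (F := ∅) le_rfl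
      fun k _ => starNorm_sq_le_fibreSymbol ξ k
    linarith
  · have := le_of_mem_eigenvalueCountSet hd (isLeast_blochEigenvalue hd ξ n).1
      (F := {round (-(ξ 0))}) (by simpa using hn)
      fun k hk => quarter_le_fibreSymbol (r := transverseNorm ξ) (by simpa using hk)
    linarith
  · obtain ⟨c, G, K, hc, hK, hG⟩ := exists_helix_parametrix hd
    obtain ⟨S, hR, hRc, hTR, hRT⟩ :=
      exists_positive_resolvent (helixOperator_form_nonneg hd) hc hK hG
    exact pmapSpectrum_subset_nonneg hc hR hRc hTR hRT
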